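/- Let $H=\ell^2\text{-}\bigoplus_{n\ge 1}\mathbb C^2$, let $\bigoplus_{n\ge1}\mathbb M_2\subset B(H)$ be the algebra of block diagonal operators with $2\times 2$ blocks, finitely many of them nonzero, and let $\mathcal M$ be its closure in the weak operator topology, equipped with the faithful normal finite trace $\tau=\bigoplus_{n\ge 1}2^{-(n+1)}\mathrm{Tr}_2$ (so $\tau(\mathbf 1)=1$), where $\mathrm{Tr}_2$ is the standard trace of $\mathbb M_2$. Let $\mathcal A$ be the $C^*$-algebra $\overline{\bigoplus_{n\ge1}\mathbb M_2}^{\|\cdot\|_\infty}\subset\mathcal M$. Let $S(\mathcal M,\tau)$ be the $*$-algebra of $\tau$-measurable operators affiliated with $\mathcal M$, with strong sums and strong products, and for $x\in S(\mathcal M,\tau)$ put $\mu(s;x)=\inf\{\|xp\|_\infty : p\in\mathcal M \text{ a projection},\ \tau(\mathbf 1-p)\le s\}$, $s>0$. For a measurable function $f:(0,1)\to\mathbb C$ let $\mu(t;f)=\inf\{s\ge 0: |\{|f|>s\}|\le t\}$, $t>0$, be its decreasing rearrangement. A symmetric function space $E(0,1)$ is a linear space of (classes of) measurable functions on $(0,1)$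 with a complete norm such that if $f$ is measurable, $g\in E(0,1)$ and $\mu(f)\le\mu(g)$, then $f\in E(0,1)$ and $\|f\|_E\le\|g\|_E$. It has the Levi property if every upwards directed net $(x_\beta)$ in $E(0,1)^+$ with $\sup_\beta\|x_\beta\|_E<\infty$ has a supremum in $E(0,1)^+$. Put $E(\mathcal M,\tau)=\{x\in S(\mathcal M,\tau):\mu(x)\in E(0,1)\}$. If $E(0,1)$ is a symmetric function space without the Levi property, then there exists an outer derivation from $\mathcal A$ into $E(\mathcal M,\tau)$; that is, there is a linear map $\delta:\mathcal A\to E(\mathcal M,\tau)$ with $\delta(xy)=\delta(x)y+x\delta(y)$ for all $x,y\in\mathcal A$ for which there is no $a\in E(\mathcal M,\tau)$ with $\delta(x)=xa-ax$ for all $x\in\mathcal A$. -/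

import Mathlib

noncomputable section

open MeasureTheory Filter Topology
open scoped ENNReal ComplexOrder

namespace OuterDerivation

/-! ### Symmetric function spaces on `(0,1)` -/

/-- Lebesgue measure on `(0,1)`. -/
abbrev vol01 : Measure ℝ := volume.restrict (Set.Ioo 0 1)

/-- `S(0,1)`: classes of complex measurable functions on `(0,1)` modulo equality a.e. -/
abbrev S01 : Type := ℝ →ₘ[vol01] ℂ

/-- Decreasing rearrangement `μ(t; f) = inf {s ≥ 0 : m(|f| > s) ≤ t}`, for `t > 0`. -/
def rearrangement (f : S01) (t : ℝ) : ℝ :=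
  sInf {s : ℝ | 0 ≤ s ∧ vol01 {u | s < ‖f u‖} ≤ ENNReal.ofReal t}

/-- A symmetric function space `E(0,1)`: a linear subspace of `S(0,1)` with a complete norm such
that `μ(f) ≤ μ(g)`, `g ∈ E` imply `f ∈ E` and `‖f‖ ≤ ‖g‖`. -/
structure SymmetricFunctionSpace where
  carrier : Submodule ℂ S01
  norm : Seminorm ℂ carrier
  eq_zero_of_norm_eq_zero : ∀ f, norm f = 0 → f = 0
  complete : ∀ u : ℕ → carrier,
    (∀ ε : ℝ, 0 < ε → ∃ N, ∀ m ≥ N, ∀ n ≥ N, norm (u m - u n) < ε) →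
      ∃ f, Tendsto (fun n => norm (u n - f)) atTop (𝓝 0)
  symmetric : ∀ (f : S01) (g : carrier),
    (∀ t : ℝ, 0 < t → rearrangement f t ≤ rearrangement g t) →
      ∃ hf : f ∈ carrier, norm ⟨f, hf⟩ ≤ norm g

/-- The Levi property: every norm-bounded upwards directed system in `E⁺` has a supremum in `E`.
(The order is the a.e. order, `0 ≤ f` meaning that `f` is real and nonnegative a.e.) -/
def SymmetricFunctionSpace.HasLevi (E : SymmetricFunctionSpace) : Prop :=
  ∀ D : Set E.carrier, D.Nonempty → DirectedOn (· ≤ ·) D → (∀ f ∈ D, 0 ≤ f) →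
    (∃ C : ℝ, ∀ f ∈ D, E.norm f ≤ C) → ∃ x : E.carrier, 0 ≤ x ∧ IsLUB D x

/-! ### Measurable operators

Here `M` is (the underlying set of) a von Neumann algebra on `H` and `τ` is a trace; `τ` is only
ever evaluated at projections of `M`. -/

section Operators

variable {H : Type*} [NormedAddCommGroup H] [InnerProductSpace ℂ H] [CompleteSpace H]

/-- `p` is a projection of `M`. -/
def IsProj (M : Set (H →L[ℂ] H)) (p : H →L[ℂ] H) : Prop :=
  p ∈ M ∧ IsStarProjection p

/-- `p` is a finite projection of `M`: not Murray-von Neumann equivalent in `M` to a proper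
subprojection. -/
def IsFiniteProj (M : Set (H →L[ℂ] H)) (p : H →L[ℂ] H) : Prop :=
  IsProj M p ∧ ∀ v ∈ M, star v * v = p → v * star v ≤ p → v * star v = p

/-- `x` is closed, densely defined and affiliated with `M`: `y x ⊆ x y` for all `y ∈ M'`. -/
def IsAffiliated (M : Set (H →L[ℂ] H)) (x : H →ₗ.[ℂ] H) : Prop :=
  x.IsClosed ∧ Dense (x.domain : Set H) ∧
    ∀ y ∈ Set.centralizer M, ∀ ξ : x.domain, ∃ h : y ξ ∈ x.domain, x ⟨y ξ, h⟩ = y (x ξ)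

/-- There are projections `pₙ ↑ 1` in `M` with `pₙ(H) ⊆ 𝔇(x)` and `1 - pₙ` satisfying `Q`. -/
def HasExhaustingProj (M : Set (H →L[ℂ] H)) (Q : (H →L[ℂ] H) → Prop) (x : H →ₗ.[ℂ] H) : Prop :=
  ∃ p : ℕ → H →L[ℂ] H, (∀ n, IsProj M (p n)) ∧ Monotone p ∧
    (∀ ξ, Tendsto (fun n => p n ξ) atTop (𝓝 ξ)) ∧
    (∀ n ξ, p n ξ ∈ x.domain) ∧ ∀ n, Q (1 - p n)

/-- `S(M)`, the measurable operators. -/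
def measurableOps (M : Set (H →L[ℂ] H)) : Set (H →ₗ.[ℂ] H) :=
  {x | IsAffiliated M x ∧ HasExhaustingProj M (IsFiniteProj M) x}

/-- `S(M, τ)`, the `τ`-measurable operators. -/
def tauMeasurableOps (M : Set (H →L[ℂ] H)) (τ : (H →L[ℂ] H) → ℝ≥0∞) : Set (H →ₗ.[ℂ] H) :=
  {x | x ∈ measurableOps M ∧ HasExhaustingProj M (fun q => τ q < ∞) x}

/-- Generalized singular value function
`μ(s; x) = inf {‖x p‖ : p a projection of M, τ(1 - p) ≤ s}`, for `s > 0`, where only those `p`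
with `x p` everywhere defined and bounded contribute. -/
def singularValue (M : Set (H →L[ℂ] H)) (τ : (H →L[ℂ] H) → ℝ≥0∞) (x : H →ₗ.[ℂ] H) (s : ℝ) : ℝ :=
  sInf {c : ℝ | 0 ≤ c ∧ ∃ p, IsProj M p ∧ τ (1 - p) ≤ ENNReal.ofReal s ∧
    ∀ ξ, ∃ h : p ξ ∈ x.domain, ‖x ⟨p ξ, h⟩‖ ≤ c * ‖ξ‖}

/-- `E(M, τ) = {x ∈ S(M, τ) : μ(x) ∈ E(0,1)}`, for `τ(1) = 1`. -/
def symmetricOps (E : SymmetricFunctionSpace) (M : Set (H →L[ℂ] H))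
    (τ : (H →L[ℂ] H) → ℝ≥0∞) : Set (H →ₗ.[ℂ] H) :=
  {x | x ∈ tauMeasurableOps M τ ∧
    ∃ f ∈ E.carrier, ∀ᵐ t ∂vol01, f t = (singularValue M τ x t : ℂ)}

/-- The product `x y` on its natural domain `{ξ ∈ 𝔇(y) : y ξ ∈ 𝔇(x)}`. -/
def rawMul (x y : H →ₗ.[ℂ] H) : H →ₗ.[ℂ] H :=
  x.comp (y.domRestrict ((x.domain.comap y.toFun).map y.domain.subtype)) (by
    rintro ⟨ξ, ⟨η, hη, rfl⟩, h⟩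
    exact hη)

/-- Strong sum: the closure of `x + y`. -/
def strongAdd (x y : H →ₗ.[ℂ] H) : H →ₗ.[ℂ] H := (x + y).closure

/-- Strong difference: the closure of `x - y`. -/
def strongSub (x y : H →ₗ.[ℂ] H) : H →ₗ.[ℂ] H := (x - y).closure

/-- Strong product: the closure of `x y`. -/
def strongMul (x y : H →ₗ.[ℂ] H) : H →ₗ.[ℂ] H := (rawMul x y).closure

/-- Strong scalar multiple: the closure of `c x` (the closure only matters for `c = 0`). -/
def strongSMul (c : ℂ) (x : H →ₗ.[ℂ] H) : H →ₗ.[ℂ] H := (c • x).closure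

/-- A bounded operator as an everywhere defined (partial) operator. -/
def ofBounded (a : H →L[ℂ] H) : H →ₗ.[ℂ] H := a.toLinearMap.toPMap ⊤

/-- `δ` is a derivation from the algebra `A` of bounded operators into the `A`-bimodule `J` of
closed operators, whose operations are the strong ones: `δ` is linear and
`δ(a b) = δ(a) b + a δ(b)`. -/
structure IsDerivation (A : NonUnitalStarSubalgebra ℂ (H →L[ℂ] H)) (J : Set (H →ₗ.[ℂ] H))
    (δ : A → (H →ₗ.[ℂ] H)) : Prop where
  map_mem : ∀ a, δ a ∈ J
  map_add : ∀ a b, δ (a + b) = strongAdd (δ a) (δ b)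
  map_smul : ∀ (c : ℂ) (a), δ (c • a) = strongSMul c (δ a)
  leibniz : ∀ a b, δ (a * b) =
    strongAdd (strongMul (δ a) (ofBounded b)) (strongMul (ofBounded a) (δ b))

/-- `δ` is inner: `δ(a) = a z - z a` for some `z ∈ J`. -/
def IsInner (A : NonUnitalStarSubalgebra ℂ (H →L[ℂ] H)) (J : Set (H →ₗ.[ℂ] H))
    (δ : A → (H →ₗ.[ℂ] H)) : Prop :=
  ∃ z ∈ J, ∀ a : A, δ a = strongSub (strongMul (ofBounded a) z) (strongMul z (ofBounded a))

end Operators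

/-! ### The direct sum of copies of `M₂` -/

/-- The Hilbert direct sum of copies of `ℂ²`. -/
abbrev HS : Type := lp (fun _ : ℕ => EuclideanSpace ℂ (Fin 2)) 2

/-- `T` acts as the block diagonal operator with diagonal blocks `m n`. -/
def IsBlockDiag (T : HS →L[ℂ] HS) (m : ℕ → Matrix (Fin 2) (Fin 2) ℂ) : Prop :=
  ∀ (ξ : HS) (n : ℕ), (T ξ) n = (m n).toEuclideanLin (ξ n)

theorem IsBlockDiag.single {T : HS →L[ℂ] HS} {m : ℕ → Matrix (Fin 2) (Fin 2) ℂ}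
    (hT : IsBlockDiag T m) (n : ℕ) (v : EuclideanSpace ℂ (Fin 2)) :
    T (lp.single 2 n v) = lp.single 2 n ((m n).toEuclideanLin v) := by
  ext1
  funext k
  rw [hT]
  by_cases hk : k = n
  · subst hk; simp
  · simp [hk]

theorem IsBlockDiag.star {T : HS →L[ℂ] HS} {m : ℕ → Matrix (Fin 2) (Fin 2) ℂ}
    (hT : IsBlockDiag T m) : IsBlockDiag (star T) fun n => (m n).conjTranspose := by
  intro ξ n
  refine ext_inner_left ℂ fun v => ?_
  have h1 := lp.inner_single_left (𝕜 := ℂ) n v (ContinuousLinearMap.adjoint T ξ)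
  have h2 := lp.inner_single_left (𝕜 := ℂ) n ((m n).toEuclideanLin v) ξ
  rw [ContinuousLinearMap.adjoint_inner_right, hT.single] at h1
  have h3 : inner ℂ v ((m n).conjTranspose.toEuclideanLin (ξ n))
      = inner ℂ ((m n).toEuclideanLin v) (ξ n) := by
    rw [Matrix.toEuclideanLin_conjTranspose_eq_adjoint, LinearMap.adjoint_inner_right]
  exact h1.symm.trans (h2.trans h3.symm)

/-- The algebraic direct sum `⊕ M₂`: block diagonal operators with finitely many nonzero blocks. -/
def algSum : NonUnitalStarSubalgebra ℂ (HS →L[ℂ] HS) where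
  carrier := {T | ∃ m : ℕ → Matrix (Fin 2) (Fin 2) ℂ, m.support.Finite ∧ IsBlockDiag T m}
  zero_mem' := ⟨0, by simp, fun ξ n => by simp⟩
  add_mem' := by
    rintro S T ⟨m, hm, hS⟩ ⟨k, hk, hT⟩
    refine ⟨m + k, (hm.union hk).subset (Function.support_add m k), fun ξ n => ?_⟩
    have h : ((S + T) ξ) n = (S ξ) n + (T ξ) n := rfl
    rw [h, hS, hT]
    simp
  mul_mem' := by
    rintro S T ⟨m, hm, hS⟩ ⟨k, hk, hT⟩
    refine ⟨m * k, hm.subset (Function.support_mul_subset_left m k), fun ξ n => ?_⟩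
    have h : ((S * T) ξ) n = (S (T ξ)) n := rfl
    rw [h, hS, hT]
    simp [Matrix.toLpLin_apply]
  smul_mem' := by
    rintro c T ⟨m, hm, hT⟩
    refine ⟨c • m, hm.subset (Function.support_const_smul_subset c m), fun ξ n => ?_⟩
    have h : ((c • T) ξ) n = c • (T ξ) n := rfl
    rw [h, hT]
    simp
  star_mem' := by
    rintro T ⟨m, hm, hT⟩
    exact ⟨fun n => (m n).conjTranspose, hm.subset fun n hn h0 => hn (by simp [h0]), hT.star⟩

/-- The C*-algebra `𝒜`, the closure of `⊕ M₂` in the operator norm. -/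
def normClosure : NonUnitalStarSubalgebra ℂ (HS →L[ℂ] HS) := algSum.topologicalClosure

/-- The von Neumann algebra `ℳ`, the closure of `⊕ M₂` in the weak operator topology. -/
def wotClosure : Set (HS →L[ℂ] HS) :=
  {T | ContinuousLinearMapWOT.ofCLM T ∈
    closure (ContinuousLinearMapWOT.ofCLM '' (algSum : Set (HS →L[ℂ] HS)))}

/-- The `n`-th diagonal block of `T`. -/
def block (T : HS →L[ℂ] HS) (n : ℕ) : Matrix (Fin 2) (Fin 2) ℂ :=
  Matrix.of fun i j => (T (lp.single 2 n (EuclideanSpace.single j 1))) n i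

/-- The trace `τ = ⊕_{n ≥ 1} 2^{-(n+1)} Tr₂` on positive elements; blocks are numbered from `0`
here, so the weight of block `n` is `2^{-(n+2)}`. -/
def trace (T : HS →L[ℂ] HS) : ℝ≥0∞ :=
  ∑' n : ℕ, ENNReal.ofReal ((1 / 2) ^ (n + 2) * (block T n).trace.re)

end OuterDerivation

end

noncomputable section

open MeasureTheory Filter Topology
open scoped ENNReal ComplexOrder

namespace OuterDerivation

/-! If the Levi property fails, there is a norm-bounded increasing sequence `g k` of nonnegative
functions in `E` whose pointwise supremum `F` is finite almost everywhere but not in `E`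
(`exists_seq_of_not_hasLevi`). Let `c n` be the value at `2^{-n}` of the decreasing rearrangement of
`F`. This sequence increases, and it is unbounded because `E` contains the constants. The derivation
is the commutator with the block diagonal operator `z` whose blocks are `c n • e_{01}`; this
operator turns out to be just too large for `E(M, τ)`.

The commutators are small enough. An element `x` of the norm closure has blocks tending to zero in
norm (`tendsto_norm_blk`), so the singular value function of `x z - z x` is at most `R + ε * c n`
for `t ≥ 2^{-(n+1)}`, for every `ε > 0` and some `R` depending on `ε`. Such a function is in `E`
(`NormLE.of_le_const_add_dyadic`): bounded functions below the dyadic profile `c` have norm at most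
`2 * C`, where `C` bounds the norms of the `g k`, so the truncations of the given function form a
Cauchy sequence, and the limit in measure is the function itself.

No implementing operator is small enough. An operator affiliated with the von Neumann algebra is
block diagonal (`IsAffiliated.exists_eq_blockOp`). If it implements the derivation, testing on
`e_{00}` in block `n` shows that its entry `(0,1)` there is `c n`. A projection whose complement has
trace below `2^{-(n+2)}`, the weight of a minimal projection of block `n`, is the identity on that
block, so the singular value function is at least `c n` on `(0, 2^{-(n+2)})`. If it were in `E`,
eight translated pieces of it plus a constant would dominate `F` in distribution
(`NormLE.of_dyadic_le`), and `F` would be in `E`.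

All strong operations reduce to blockwise ones because finitely supported vectors form a core
(`closure_eq_blockOp`). -/

/-! ### Distribution functions and decreasing rearrangements -/

/-- The distribution function of an element of `S(0,1)` tends to zero. -/
theorem exists_distribution_le (g : S01) {t : ℝ} (ht : 0 < t) :
    ∃ s : ℝ, 0 ≤ s ∧ vol01 {u | s < ‖g u‖} ≤ ENNReal.ofReal t := by
  have hm : ∀ n : ℕ, MeasurableSet {u | (n : ℝ) < ‖g u‖} := fun n =>
    measurableSet_lt measurable_const g.measurable.norm
  have h := tendsto_measure_iInter_atTop (μ := vol01) (s := fun n : ℕ => {u | (n : ℝ) < ‖g u‖})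
    (fun n => (hm n).nullMeasurableSet)
    (fun m n hmn u (hu : (n : ℝ) < ‖g u‖) => lt_of_le_of_lt (by exact_mod_cast hmn) hu)
    ⟨0, measure_ne_top _ _⟩
  have h0 : (⋂ n : ℕ, {u | (n : ℝ) < ‖g u‖}) = ∅ := by
    ext u
    simp only [Set.mem_iInter, Set.mem_ofPred_eq, Set.mem_empty_iff_false, iff_false, not_forall,
      not_lt]
    exact exists_nat_ge _
  rw [h0, measure_empty] at h
  obtain ⟨n, hn⟩ := (h.eventually (gt_mem_nhds (ENNReal.ofReal_pos.2 ht))).exists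
  exact ⟨n, n.cast_nonneg, hn.le⟩

theorem rearrangement_le_of_distribution_le {f g : S01}
    (h : ∀ s : ℝ, 0 ≤ s → vol01 {u | s < ‖f u‖} ≤ vol01 {u | s < ‖g u‖}) {t : ℝ} (ht : 0 < t) :
    rearrangement f t ≤ rearrangement g t :=
  csInf_le_csInf ⟨0, fun _ hs => hs.1⟩ (exists_distribution_le g ht)
    fun s hs => ⟨hs.1, (h s hs.1).trans hs.2⟩

theorem lt_distribution_of_lt_rearrangement {f : S01} {s t : ℝ} (hs : 0 ≤ s)
    (h : s < rearrangement f t) : ENNReal.ofReal t < vol01 {u | s < ‖f u‖} := by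
  by_contra hc
  exact notMem_of_lt_csInf h ⟨0, fun _ hs => hs.1⟩ ⟨hs, not_lt.1 hc⟩

theorem le_rearrangement_of_lt_distribution {f : S01} {s t : ℝ} (ht : 0 < t)
    (h : ENNReal.ofReal t < vol01 {u | s < ‖f u‖}) : s ≤ rearrangement f t := by
  refine le_csInf (exists_distribution_le f ht) fun r hr => ?_
  by_contra hc
  exact absurd (h.trans_le ((measure_mono fun u (hu : s < ‖f u‖) => (not_le.1 hc).trans hu).trans
    hr.2)) (lt_irrefl _)

theorem rearrangement_nonneg (f : S01) (t : ℝ) : 0 ≤ rearrangement f t :=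
  Real.sInf_nonneg fun _ hs => hs.1

theorem rearrangement_anti (f : S01) {s t : ℝ} (hs : 0 < s) (hst : s ≤ t) :
    rearrangement f t ≤ rearrangement f s :=
  csInf_le_csInf ⟨0, fun _ h => h.1⟩ (exists_distribution_le f hs)
    fun _ h => ⟨h.1, h.2.trans (ENNReal.ofReal_le_ofReal hst)⟩

/-! ### Norm estimates in `E` for real functions -/

/-- The class of the real function `h` belongs to `E`, with norm at most `C`. -/
def SymmetricFunctionSpace.NormLE (E : SymmetricFunctionSpace) (h : ℝ → ℝ) (C : ℝ) : Prop :=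
  ∃ f : E.carrier, (∀ᵐ t ∂vol01, (f : S01) t = (h t : ℂ)) ∧ E.norm f ≤ C

namespace SymmetricFunctionSpace

variable {E : SymmetricFunctionSpace}

theorem distribution_congr {f : S01} {h : ℝ → ℝ} (hf : ∀ᵐ t ∂vol01, f t = (h t : ℂ)) (s : ℝ) :
    vol01 {u | s < ‖f u‖} = vol01 {u | s < |h u|} := by
  refine measure_congr ?_
  filter_upwards [hf] with u hu
  refine propext ?_
  change s < ‖f u‖ ↔ s < |h u|
  rw [hu, Complex.norm_real, Real.norm_eq_abs]

theorem norm_le_of_ae_eq {h : ℝ → ℝ} {C : ℝ} (H : E.NormLE h C) (f : E.carrier)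
    (hf : ∀ᵐ t ∂vol01, (f : S01) t = (h t : ℂ)) : E.norm f ≤ C := by
  obtain ⟨g, hg, hC⟩ := H
  have : f = g := Subtype.ext (AEEqFun.ext (by filter_upwards [hf, hg] with t h1 h2; rw [h1, h2]))
  rwa [this]

theorem NormLE.of_distribution_le {h g : ℝ → ℝ} {C : ℝ} (hg : E.NormLE g C)
    (hm : AEMeasurable h vol01)
    (hd : ∀ s : ℝ, 0 ≤ s → vol01 {u | s < |h u|} ≤ vol01 {u | s < |g u|}) : E.NormLE h C := by
  obtain ⟨f, hf, hC⟩ := hg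
  have hm' : AEStronglyMeasurable (fun t => (h t : ℂ)) vol01 :=
    (Complex.measurable_ofReal.comp_aemeasurable hm).aestronglyMeasurable
  have hk : ∀ᵐ t ∂vol01, AEEqFun.mk _ hm' t = (h t : ℂ) := AEEqFun.coeFn_mk _ hm'
  obtain ⟨hmem, hn⟩ := E.symmetric (AEEqFun.mk _ hm') f fun t ht =>
    rearrangement_le_of_distribution_le (fun s hs => by
      rw [distribution_congr hk, distribution_congr hf]; exact hd s hs) ht
  exact ⟨⟨_, hmem⟩, hk, hn.trans hC⟩

theorem NormLE.of_abs_le {h g : ℝ → ℝ} {C : ℝ} (hg : E.NormLE g C)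
    (hm : AEMeasurable h vol01) (hd : ∀ᵐ u ∂vol01, |h u| ≤ |g u|) : E.NormLE h C :=
  hg.of_distribution_le hm fun s _ => measure_mono_ae (by
    filter_upwards [hd] with u hu (hs : s < |h u|) using lt_of_lt_of_le hs hu)

theorem NormLE.congr {h g : ℝ → ℝ} {C : ℝ} (hg : E.NormLE g C)
    (hd : ∀ᵐ u ∂vol01, h u = g u) : E.NormLE h C := by
  obtain ⟨f, hf, hC⟩ := hg
  exact ⟨f, by filter_upwards [hf, hd] with u h1 h2; rw [h1, h2], hC⟩

theorem NormLE.nonneg {h : ℝ → ℝ} {C : ℝ} (hg : E.NormLE h C) : 0 ≤ C :=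
  let ⟨f, _, hn⟩ := hg
  (apply_nonneg E.norm f).trans hn

theorem NormLE.aemeasurable {h : ℝ → ℝ} {C : ℝ} (hg : E.NormLE h C) : AEMeasurable h vol01 := by
  obtain ⟨f, hf, -⟩ := hg
  refine ⟨fun t => ((f : S01) t).re, Complex.measurable_re.comp (f : S01).measurable, ?_⟩
  filter_upwards [hf] with t ht
  rw [ht, Complex.ofReal_re]

theorem NormLE.add {h g : ℝ → ℝ} {C C' : ℝ} (hh : E.NormLE h C) (hg : E.NormLE g C') :
    E.NormLE (fun t => h t + g t) (C + C') := by
  obtain ⟨a, ha, hC⟩ := hh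
  obtain ⟨b, hb, hC'⟩ := hg
  refine ⟨a + b, ?_, (map_add_le_add E.norm a b).trans (add_le_add hC hC')⟩
  filter_upwards [ha, hb, AEEqFun.coeFn_add (a : S01) (b : S01)] with t h1 h2 h3
  rw [Submodule.coe_add, h3, Pi.add_apply, h1, h2, Complex.ofReal_add]

theorem NormLE.const_mul {h : ℝ → ℝ} {C : ℝ} (hh : E.NormLE h C) {r : ℝ} (hr : 0 ≤ r) :
    E.NormLE (fun t => r * h t) (r * C) := by
  obtain ⟨a, ha, hC⟩ := hh
  refine ⟨(r : ℂ) • a, ?_, ?_⟩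
  · filter_upwards [ha, AEEqFun.coeFn_smul (r : ℂ) (a : S01)] with t h1 h3
    rw [Submodule.coe_smul, h3, Pi.smul_apply, h1, smul_eq_mul, Complex.ofReal_mul]
  · rw [map_smul_eq_mul, Complex.norm_real, Real.norm_of_nonneg hr]
    exact mul_le_mul_of_nonneg_left hC hr

theorem normLE_zero : E.NormLE (fun _ => 0) 0 := by
  refine ⟨0, ?_, by simp⟩
  filter_upwards [AEEqFun.coeFn_zero (α := ℝ) (β := ℂ) (μ := vol01)] with t ht
  simpa using ht

theorem NormLE.sum {ι : Type*} (s : Finset ι) {h : ι → ℝ → ℝ} {C : ι → ℝ}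
    (hh : ∀ i ∈ s, E.NormLE (h i) (C i)) :
    E.NormLE (fun t => ∑ i ∈ s, h i t) (∑ i ∈ s, C i) := by
  classical
  induction s using Finset.induction_on with
  | empty => simpa using normLE_zero
  | insert i s hi ih =>
    simp only [Finset.sum_insert hi]
    exact (hh i (Finset.mem_insert_self _ _)).add
      (ih fun j hj => hh j (Finset.mem_insert_of_mem hj))

theorem vol01_Ioo {a b : ℝ} (ha : 0 ≤ a) (hb : b ≤ 1) :
    vol01 (Set.Ioo a b) = ENNReal.ofReal (b - a) := by
  rw [Measure.restrict_apply measurableSet_Ioo, Set.inter_eq_left.2 (Set.Ioo_subset_Ioo ha hb),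
    Real.volume_Ioo]

theorem vol01_Iio_le {b : ℝ} : vol01 (Set.Iio b) ≤ ENNReal.ofReal b := by
  rw [Measure.restrict_apply measurableSet_Iio]
  refine (measure_mono (t := Set.Ioo 0 b) fun x hx => ⟨hx.2.1, hx.1⟩).trans ?_
  rw [Real.volume_Ioo, sub_zero]

theorem vol01_le_one (s : Set ℝ) : vol01 s ≤ 1 := by
  refine (measure_mono (Set.subset_univ s)).trans ?_
  rw [Measure.restrict_apply_univ, Real.volume_Ioo]
  simp

/-- If some function of `E` exceeds `r ≥ 0` on a set of measure at least `m(A)`, then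
`r 1_A` is in `E`. -/
theorem NormLE.indicator {h : ℝ → ℝ} {C r : ℝ} (hh : E.NormLE h C) (hr : 0 ≤ r) {A : Set ℝ}
    (hA : MeasurableSet A) (hm : vol01 A ≤ vol01 {u | r < |h u|}) :
    E.NormLE (A.indicator fun _ => r) C := by
  refine hh.of_distribution_le (measurable_const.indicator hA).aemeasurable fun s hs => ?_
  rcases lt_or_ge s r with hsr | hsr
  · refine (measure_mono fun u hu => ?_).trans
      (hm.trans (measure_mono fun u (hu : r < |h u|) => hsr.trans hu))
    by_contra hA
    rw [Set.mem_ofPred_eq, Set.indicator_of_notMem hA, abs_zero] at hu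
    exact absurd hu (not_lt.2 hs)
  · refine (measure_mono (t := ∅) fun u hu => ?_).trans (by simp)
    rw [Set.mem_ofPred_eq] at hu
    by_cases hA : u ∈ A
    · rw [Set.indicator_of_mem hA, abs_of_nonneg hr] at hu
      exact absurd hu (not_lt.2 hsr)
    · rw [Set.indicator_of_notMem hA, abs_zero] at hu
      exact absurd hu (not_lt.2 hs)

theorem normLE_norm (f : E.carrier) : E.NormLE (fun u => ‖(f : S01) u‖) (E.norm f) := by
  have hm : AEStronglyMeasurable (fun u => ((‖(f : S01) u‖ : ℝ) : ℂ)) vol01 :=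
    (Complex.measurable_ofReal.comp (f : S01).measurable.norm).aestronglyMeasurable
  have hk : ∀ᵐ t ∂vol01, AEEqFun.mk _ hm t = ((‖(f : S01) t‖ : ℝ) : ℂ) := AEEqFun.coeFn_mk _ hm
  obtain ⟨h1, h2⟩ := E.symmetric (AEEqFun.mk _ hm) f fun t ht =>
    rearrangement_le_of_distribution_le (fun s hs => by
      rw [distribution_congr hk]; simp) ht
  exact ⟨⟨_, h1⟩, hk, h2⟩

/-- A nonzero symmetric function space contains the constants. -/
theorem exists_normLE_one (f : E.carrier) (hf : f ≠ 0) : ∃ C, E.NormLE (fun _ => 1) C := by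
  have hmeas : ∀ n : ℕ, MeasurableSet {u | 1 / ((n : ℝ) + 1) < ‖(f : S01) u‖} := fun n =>
    measurableSet_lt measurable_const (f : S01).measurable.norm
  have hpos : ∃ n : ℕ, 0 < vol01 {u | 1 / ((n : ℝ) + 1) < ‖(f : S01) u‖} := by
    by_contra hc
    push Not at hc
    refine hf (Subtype.ext (AEEqFun.ext ?_))
    have h1 : ∀ᵐ u ∂vol01, ∀ n : ℕ, ¬ (1 / ((n : ℝ) + 1) < ‖(f : S01) u‖) :=
      ae_all_iff.2 fun n => by
        rw [ae_iff]
        simpa using hc n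
    filter_upwards [h1, AEEqFun.coeFn_zero (α := ℝ) (β := ℂ) (μ := vol01)] with u hu h0
    rw [Submodule.coe_zero, h0, Pi.zero_apply]
    by_contra hne
    obtain ⟨n, hn⟩ := exists_nat_one_div_lt (norm_pos_iff.2 hne)
    exact hu n hn
  obtain ⟨n, hn⟩ := hpos
  set r : ℝ := 1 / ((n : ℝ) + 1) with hr
  have hr0 : 0 < r := Nat.one_div_pos_of_nat
  -- An interval of length `1 / N` is no larger than the set where `‖f‖ > r`, so by symmetry `r`
  -- times its indicator is in `E`; `N` such intervals tile `[0,1)`.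
  obtain ⟨N, hN⟩ := ENNReal.exists_inv_nat_lt hn.ne'
  have hN0 : 0 < N := by
    rcases Nat.eq_zero_or_pos N with h | h
    · subst h; simp at hN
    · exact h
  have hN0' : (0 : ℝ) < N := by exact_mod_cast hN0
  have hI : ∀ i ∈ Finset.range N, E.NormLE
      ((Set.Ico ((i : ℝ) / N) ((i + 1 : ℝ) / N)).indicator fun _ => r) (E.norm f) := by
    intro i _
    refine (normLE_norm f).indicator hr0.le measurableSet_Ico ?_
    simp only [abs_norm]
    refine (Measure.restrict_apply_le _ _).trans (le_trans (le_of_eq ?_) hN.le)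
    rw [Real.volume_Ico, ← sub_div, add_sub_cancel_left, one_div, ENNReal.ofReal_inv_of_pos hN0',
      ENNReal.ofReal_natCast]
  have hsum := (NormLE.sum _ hI).const_mul (inv_nonneg.2 hr0.le)
  refine ⟨_, hsum.congr ?_⟩
  rw [ae_restrict_iff' measurableSet_Ioo]
  refine Eventually.of_forall fun u hu => ?_
  have hfl : ⌊u * N⌋₊ < N := by
    rw [Nat.floor_lt (by nlinarith [hu.1])]
    nlinarith [hu.2]
  rw [Finset.sum_eq_single ⌊u * N⌋₊]
  · rw [Set.indicator_of_mem, inv_mul_cancel₀ hr0.ne']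
    constructor
    · rw [div_le_iff₀ hN0']
      exact Nat.floor_le (by nlinarith [hu.1])
    · rw [lt_div_iff₀ hN0']
      exact Nat.lt_floor_add_one _
  · intro i _ hi
    refine Set.indicator_of_notMem (fun hmem => hi ?_) _
    have h1 := (div_le_iff₀ hN0').1 hmem.1
    have h2 := (lt_div_iff₀ hN0').1 hmem.2
    exact ((Nat.floor_eq_iff (by nlinarith [hu.1])).2 ⟨h1, h2⟩).symm
  · intro h
    exact absurd (Finset.mem_range.2 hfl) h

/-- Convergence in norm implies convergence in measure. -/
theorem exists_mul_le_of_le_distribution {K : ℝ} (h1 : E.NormLE (fun _ => 1) K) {η : ℝ}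
    (hη : 0 < η) :
    ∃ κ : ℝ, 0 < κ ∧ ∀ (h : ℝ → ℝ) (C s : ℝ), E.NormLE h C → 0 ≤ s →
      ENNReal.ofReal η ≤ vol01 {u | s < |h u|} → s * κ ≤ C := by
  -- The cap at `1` keeps the interval inside `(0,1)`. The constant `κ` will be the norm of the
  -- indicator of `(0, η')`, positive since the norm is definite.
  set η' := min η 1
  have hη' : 0 < η' := lt_min hη one_pos
  have hvol : vol01 (Set.Ioo 0 η') = ENNReal.ofReal η' := by
    rw [vol01_Ioo le_rfl (min_le_right _ _), sub_zero]
  have hind : E.NormLE ((Set.Ioo 0 η').indicator fun _ => 1) K :=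
    h1.of_abs_le (measurable_const.indicator measurableSet_Ioo).aemeasurable
      (Eventually.of_forall fun u => by
        by_cases hu : u ∈ Set.Ioo 0 η'
        · rw [Set.indicator_of_mem hu]
        · rw [Set.indicator_of_notMem hu]; simp)
  obtain ⟨f, hf, -⟩ := hind
  have hf0 : f ≠ 0 := by
    rintro rfl
    have h0 : ∀ᵐ u ∂vol01, u ∉ Set.Ioo 0 η' := by
      filter_upwards [hf, AEEqFun.coeFn_zero (α := ℝ) (β := ℂ) (μ := vol01)] with u h1 h2 hu
      rw [Submodule.coe_zero, h2, Set.indicator_of_mem hu] at h1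
      simp at h1
    have h0' : vol01 (Set.Ioo 0 η') = 0 := by
      rw [← compl_compl (Set.Ioo 0 η')]
      exact mem_ae_iff.1 h0
    rw [hvol] at h0'
    exact absurd h0' (ENNReal.ofReal_pos.2 hη').ne'
  refine ⟨E.norm f, lt_of_le_of_ne (apply_nonneg E.norm f)
    fun h => hf0 (E.eq_zero_of_norm_eq_zero f h.symm), fun h C s hC hs hle => ?_⟩
  have h2 := hC.indicator (A := Set.Ioo 0 η') hs measurableSet_Ioo
    ((hvol.le.trans (ENNReal.ofReal_le_ofReal (min_le_left _ _))).trans hle)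
  have h3 := norm_le_of_ae_eq h2 ((s : ℂ) • f) (by
    filter_upwards [hf, AEEqFun.coeFn_smul (s : ℂ) (f : S01)] with u h1 h3
    rw [Submodule.coe_smul, h3, Pi.smul_apply, h1]
    by_cases hu : u ∈ Set.Ioo 0 η'
    · simp [Set.indicator_of_mem hu]
    · simp [Set.indicator_of_notMem hu])
  rwa [map_smul_eq_mul, Complex.norm_real, Real.norm_of_nonneg hs] at h3

theorem ae_eq_norm_of_nonneg {f : S01} (hf : 0 ≤ f) : ∀ᵐ u ∂vol01, f u = ((‖f u‖ : ℝ) : ℂ) := by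
  filter_upwards [AEEqFun.coeFn_le.2 hf, AEEqFun.coeFn_zero (α := ℝ) (β := ℂ) (μ := vol01)]
    with u h h0
  rw [h0, Pi.zero_apply] at h
  exact Complex.eq_coe_norm_of_nonneg h

theorem ae_norm_le_norm_of_le {f g : S01} (hf : 0 ≤ f) (hfg : f ≤ g) :
    ∀ᵐ u ∂vol01, ‖f u‖ ≤ ‖g u‖ := by
  filter_upwards [ae_eq_norm_of_nonneg hf, ae_eq_norm_of_nonneg (hf.trans hfg),
    AEEqFun.coeFn_le.2 hfg] with u h1 h2 h3
  rw [h1, h2] at h3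
  exact_mod_cast h3

/-! ### From failure of the Levi property to a sequence -/

/-- In a space without the Levi property there is a norm bounded increasing sequence of
nonnegative functions whose pointwise supremum is finite but not in the space. -/
theorem exists_seq_of_not_hasLevi (hE : ¬ E.HasLevi) :
    ∃ (g : ℕ → ℝ → ℝ) (F : ℝ → ℝ) (C K : ℝ), E.NormLE (fun _ => 1) K ∧
      (∀ k, E.NormLE (g k) C) ∧ Monotone g ∧ Measurable F ∧ (∀ u, 0 ≤ F u) ∧
      (∀ u q, q < F u → ∃ k, q < g k u) ∧
      ∀ C', ¬ E.NormLE F C' := by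
  unfold HasLevi at hE
  push Not at hE
  obtain ⟨D, hD, hdir, hpos, ⟨C, hC⟩, hsup⟩ := hE
  have hpos' : ∀ d ∈ D, (0 : S01) ≤ d := fun d hd => hpos d hd
  -- If the constants were missing, `E` would be zero and `0` would be the supremum of `D`.
  obtain ⟨K, hK⟩ : ∃ K, E.NormLE (fun _ => 1) K := by
    by_contra hc
    have h0 : ∀ d ∈ D, d = 0 := fun d _ => by
      by_contra hd
      exact hc (exists_normLE_one d hd)
    obtain ⟨d, hd⟩ := hD
    refine hsup 0 le_rfl ⟨fun d hd => (h0 d hd).le, fun y hy => ?_⟩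
    rw [← h0 d hd]
    exact hy hd
  let φ : D → ℝ → ℝ := fun d u => ‖((d : E.carrier) : S01) u‖
  have hφm : ∀ d, Measurable (φ d) := fun d => ((d : E.carrier) : S01).measurable.norm
  have hφ0 : ∀ d u, 0 ≤ φ d u := fun d u => norm_nonneg _
  have hφE : ∀ d, E.NormLE (φ d) C := fun d =>
    ⟨d, ae_eq_norm_of_nonneg (hpos' d d.2), hC d d.2⟩
  have hφmono : ∀ d d' : D, d ≤ d' → ∀ᵐ u ∂vol01, φ d u ≤ φ d' u := fun d d' h =>
    ae_norm_le_norm_of_le (hpos' d d.2) h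
  -- a monotone sequence maximizing a strictly monotone functional
  let J : ℝ → ℝ≥0∞ := fun x => ENNReal.ofReal (Real.arctan x)
  have hJ : Measurable J := Real.measurable_arctan.ennreal_ofReal
  have hJmono : Monotone J := fun x y h =>
    ENNReal.ofReal_le_ofReal (Real.arctan_strictMono.monotone h)
  let I : (ℝ → ℝ) → ℝ≥0∞ := fun h => ∫⁻ u, J (h u) ∂vol01
  let S : ℝ≥0∞ := ⨆ d : D, I (φ d)
  have hSfin : S ≠ ∞ := by
    refine ne_top_of_le_ne_top (b := ENNReal.ofReal (Real.pi / 2)) ENNReal.ofReal_ne_top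
      (iSup_le fun d => ?_)
    calc I (φ d) ≤ ∫⁻ _, ENNReal.ofReal (Real.pi / 2) ∂vol01 :=
          lintegral_mono fun u => ENNReal.ofReal_le_ofReal (Real.arctan_lt_pi_div_two _).le
      _ = ENNReal.ofReal (Real.pi / 2) * vol01 Set.univ := lintegral_const _
      _ ≤ _ := mul_le_of_le_one_right zero_le (vol01_le_one _)
  have : Nonempty D := hD.to_subtype
  obtain ⟨v, -, hvS, hv⟩ := exists_seq_tendsto_sSup (Set.range_nonempty fun d : D => I (φ d))
    (OrderTop.bddAbove _)
  choose w hw using hv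
  have hdir' : ∀ a b : D, ∃ c : D, a ≤ c ∧ b ≤ c := fun a b => by
    obtain ⟨c, hc, h1, h2⟩ := hdir a a.2 b b.2
    exact ⟨⟨c, hc⟩, h1, h2⟩
  choose b hb1 hb2 using hdir'
  -- Directedness replaces the maximizing sequence `w` by an increasing sequence above it.
  let e : ℕ → D := fun n => Nat.rec (w 0) (fun n x => b x (w (n + 1))) n
  have hemono : Monotone e := monotone_nat_of_le_succ fun n => hb1 _ _
  have hwe : ∀ n, w n ≤ e n := fun n => by
    cases n with
    | zero => exact le_rfl
    | succ n => exact hb2 _ _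
  have hIe : Tendsto (fun n => I (φ (e n))) atTop (𝓝 S) := by
    refine tendsto_of_tendsto_of_tendsto_of_le_of_le hvS tendsto_const_nhds (fun n => ?_)
      fun n => le_iSup (fun d : D => I (φ d)) (e n)
    rw [← hw n]
    exact lintegral_mono_ae (by
      filter_upwards [hφmono _ _ (hwe n)] with u hu using hJmono hu)
  -- Partial suprema turn monotonicity almost everywhere into monotonicity at every point, changing
  -- each function only on a null set.
  let g : ℕ → ℝ → ℝ := fun k u => partialSups (fun j => φ (e j) u) k
  have hgmono : Monotone g := fun k l h u => (partialSups _).monotone h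
  have hge : ∀ᵐ u ∂vol01, ∀ k, g k u = φ (e k) u := by
    have : ∀ᵐ u ∂vol01, ∀ j, ∀ k, j ≤ k → φ (e j) u ≤ φ (e k) u :=
      ae_all_iff.2 fun j => ae_all_iff.2 fun k => by
        by_cases h : j ≤ k
        · filter_upwards [hφmono _ _ (hemono h)] with u hu _ using hu
        · exact Eventually.of_forall fun u h' => absurd h' h
    filter_upwards [this] with u hu k
    exact le_antisymm (partialSups_le _ _ _ fun j hj => hu j k hj)
      (le_partialSups (fun j => φ (e j) u) k)
  have hgm : ∀ k, Measurable (g k) := fun k => by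
    have : g k = partialSups (fun j => φ (e j)) k := by
      funext u
      exact (Pi.partialSups_apply _ _ _).symm
    rw [this, partialSups_eq_sup'_range]
    exact Finset.measurable_sup' _ fun j _ => hφm _
  have hg0 : ∀ k u, 0 ≤ g k u := fun k u =>
    (hφ0 (e k) u).trans (le_partialSups (fun j => φ (e j) u) k)
  have hgE : ∀ k, E.NormLE (g k) C := fun k => (hφE (e k)).congr (by
    filter_upwards [hge] with u hu using hu k)
  -- Where the supremum is infinite this takes the default value `0`; `hbdd` shows that this happens
  -- only on a null set, since the norm bound controls the measure of `{g k > s}` uniformly in `k`.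
  let F : ℝ → ℝ := fun u => ⨆ k, g k u
  have hFm : Measurable F := Measurable.iSup hgm
  have hbdd : ∀ᵐ u ∂vol01, BddAbove (Set.range fun k => g k u) := by
    rw [ae_iff]
    refine le_antisymm (ENNReal.le_of_forall_pos_le_add fun η hη _ => ?_) zero_le
    rw [zero_add]
    obtain ⟨κ, hκ, hκ'⟩ := exists_mul_le_of_le_distribution hK (η := η) (by exact_mod_cast hη)
    have hC0 : 0 ≤ C := (hgE 0).nonneg
    have hs : 0 ≤ C / κ + 1 := by positivity
    have hlt : ∀ k, vol01 {u | C / κ + 1 < g k u} ≤ η := fun k => by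
      by_contra hc
      have := hκ' (g k) C (C / κ + 1) (hgE k) hs (by
        simp only [abs_of_nonneg (hg0 k _)]
        rw [ENNReal.ofReal_coe_nnreal]
        exact (not_le.1 hc).le)
      rw [add_mul, div_mul_cancel₀ _ hκ.ne'] at this
      linarith
    calc vol01 {u | ¬ BddAbove (Set.range fun k => g k u)}
        ≤ vol01 (⋃ k, {u | C / κ + 1 < g k u}) := measure_mono fun u hu => by
          by_contra hc
          simp only [Set.mem_iUnion, Set.mem_ofPred_eq, not_exists, not_lt] at hc
          exact hu ⟨_, Set.forall_mem_range.2 hc⟩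
      _ = ⨆ k, vol01 {u | C / κ + 1 < g k u} := Monotone.measure_iUnion
          fun k l h u (hu : _ < g k u) => lt_of_lt_of_le hu (hgmono h u)
      _ ≤ η := iSup_le hlt
  refine ⟨g, F, C, K, hK, hgE, hgmono, hFm, fun u => Real.iSup_nonneg fun k => hg0 k u,
    fun u q hq => exists_lt_of_lt_ciSup hq, fun C' ⟨x, hx, _⟩ => ?_⟩
  have hgF : ∀ᵐ u ∂vol01, ∀ k, g k u ≤ F u := by
    filter_upwards [hbdd] with u hu k using le_ciSup hu k
  have hF0 : ∀ u, 0 ≤ F u := fun u => Real.iSup_nonneg fun k => hg0 k u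
  -- Were `F` in `E`, its class would be the supremum of `D`, including the members of `D` outside
  -- the chosen sequence.
  refine hsup x ?_ ⟨fun d hd => ?_, fun y hy => ?_⟩
  · change (0 : S01) ≤ x
    rw [← AEEqFun.coeFn_le]
    filter_upwards [hx, AEEqFun.coeFn_zero (α := ℝ) (β := ℂ) (μ := vol01)] with u h1 h2
    rw [h1, h2, Pi.zero_apply]
    exact_mod_cast hF0 u
  -- An upper bound in `D` of `d` and `e k` has functional at least `I (φ (e k))` plus this integral
  -- of a truncated difference. As `I (φ (e k))` tends to the finite maximum `S`, the integral must
  -- vanish, that is, `d ≤ F` almost everywhere.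
  · have hzero : ∫⁻ u, (J (φ ⟨d, hd⟩ u) - J (F u)) ∂vol01 = 0 := by
      have hle : ∀ k, ∫⁻ u, (J (φ ⟨d, hd⟩ u) - J (F u)) ∂vol01 + I (φ (e k)) ≤ S := fun k => by
        calc ∫⁻ u, (J (φ ⟨d, hd⟩ u) - J (F u)) ∂vol01 + I (φ (e k))
            = ∫⁻ u, (J (φ ⟨d, hd⟩ u) - J (F u)) + J (φ (e k) u) ∂vol01 :=
              (lintegral_add_right _ (hJ.comp (hφm _))).symm
          _ ≤ I (φ (b ⟨d, hd⟩ (e k))) := lintegral_mono_ae (by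
              filter_upwards [hge, hgF, hφmono _ _ (hb1 ⟨d, hd⟩ (e k)),
                hφmono _ _ (hb2 ⟨d, hd⟩ (e k))] with u h1 h2 h3 h4
              have h5 : J (φ (e k) u) ≤ J (F u) := hJmono (by rw [← h1 k]; exact h2 k)
              calc _ ≤ (J (φ ⟨d, hd⟩ u) - J (φ (e k) u)) + J (φ (e k) u) :=
                    add_le_add_left (tsub_le_tsub_left h5 _) _
                _ = max (J (φ ⟨d, hd⟩ u)) (J (φ (e k) u)) := tsub_add_eq_max
                _ ≤ _ := max_le (hJmono h3) (hJmono h4))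
          _ ≤ S := le_iSup (fun d : D => I (φ d)) _
      have h := le_of_tendsto' (hIe.const_add _) hle
      have h' : ∫⁻ u, (J (φ ⟨d, hd⟩ u) - J (F u)) ∂vol01 + S ≤ 0 + S := by rwa [zero_add]
      exact le_antisymm ((ENNReal.add_le_add_iff_right hSfin).1 h') zero_le
    replace hzero := (lintegral_eq_zero_iff
      ((hJ.comp (hφm ⟨d, hd⟩)).sub (hJ.comp hFm))).1 hzero
    change (d : S01) ≤ x
    rw [← AEEqFun.coeFn_le]
    filter_upwards [hx, ae_eq_norm_of_nonneg (hpos' d hd), hzero] with u h1 h2 h3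
    rw [h1, h2]
    have h4 : J (φ ⟨d, hd⟩ u) ≤ J (F u) := tsub_eq_zero_iff_le.1 h3
    have h5 := (ENNReal.ofReal_le_ofReal_iff (Real.arctan_nonneg.2 (hF0 u))).1 h4
    have h6 : φ ⟨d, hd⟩ u ≤ F u := Real.arctan_strictMono.le_iff_le.1 h5
    exact_mod_cast h6
  · change (x : S01) ≤ y
    rw [← AEEqFun.coeFn_le]
    have hy' : ∀ᵐ u ∂vol01, ∀ k, ((φ (e k) u : ℝ) : ℂ) ≤ (y : S01) u := ae_all_iff.2 fun k => by
      have h1 : ((e k : E.carrier) : S01) ≤ y := hy (e k).2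
      filter_upwards [AEEqFun.coeFn_le.2 h1, ae_eq_norm_of_nonneg (hpos' _ (e k).2)] with u h2 h3
      rwa [h3] at h2
    filter_upwards [hx, hy', hge] with u h1 h2 h3
    rw [h1, Complex.le_def]
    refine ⟨?_, (Complex.le_def.1 (h2 0)).2⟩
    exact ciSup_le fun k => by rw [h3 k]; exact (Complex.le_def.1 (h2 k)).1

/-! ### Comparison with the dyadic rearrangement -/

/-- The values of the decreasing rearrangement of `F` at the points `2^{-n}`. -/
theorem exists_dyadic_rearrangement {F : ℝ → ℝ} (hF : Measurable F) (hF0 : ∀ u, 0 ≤ F u) :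
    ∃ c : ℕ → ℝ, (∀ n, 0 ≤ c n) ∧ Monotone c ∧
      (∀ n s, 0 ≤ s → s < c n → ENNReal.ofReal ((1 / 2) ^ n) < vol01 {u | s < F u}) ∧
      ∀ n s, ENNReal.ofReal ((1 / 2) ^ n) < vol01 {u | s < F u} → s ≤ c n := by
  have hm : AEStronglyMeasurable (fun u => (F u : ℂ)) vol01 :=
    (Complex.measurable_ofReal.comp hF).aestronglyMeasurable
  have hd : ∀ s, vol01 {u | s < ‖AEEqFun.mk _ hm u‖} = vol01 {u | s < F u} := fun s => by
    rw [distribution_congr (AEEqFun.coeFn_mk _ hm)]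
    simp only [abs_of_nonneg (hF0 _)]
  refine ⟨fun n => rearrangement (AEEqFun.mk _ hm) ((1 / 2) ^ n),
    fun n => rearrangement_nonneg _ _, fun m n hmn => rearrangement_anti _ (by positivity)
      (pow_le_pow_of_le_one (by norm_num) (by norm_num) hmn), fun n s hs h => ?_, fun n s h => ?_⟩
  · rw [← hd]
    exact lt_distribution_of_lt_rearrangement hs h
  · rw [← hd] at h
    exact le_rearrangement_of_lt_distribution (by positivity) h

theorem exists_half_pow_lt {x : ℝ≥0∞} (hx : x ≠ 0) :
    ∃ n : ℕ, ENNReal.ofReal ((1 / 2) ^ n) < x := by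
  have h : Tendsto (fun n : ℕ => ENNReal.ofReal ((1 / 2) ^ n)) atTop (𝓝 (ENNReal.ofReal 0)) :=
    ENNReal.tendsto_ofReal (tendsto_pow_atTop_nhds_zero_of_lt_one (by norm_num) (by norm_num))
  rw [ENNReal.ofReal_zero] at h
  exact (h.eventually (gt_mem_nhds (pos_iff_ne_zero.2 hx))).exists

/-- If `w` dominates the dyadic rearrangement of `F`, dilated by a constant, and `w` is in `E`,
then `F` is in `E`. -/
theorem NormLE.of_dyadic_le {F w : ℝ → ℝ} {c : ℕ → ℝ} {C K : ℝ} (hF : Measurable F)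
    (hF0 : ∀ u, 0 ≤ F u) (hK : E.NormLE (fun _ => 1) K)
    (hc : ∀ n s, ENNReal.ofReal ((1 / 2) ^ n) < vol01 {u | s < F u} → s ≤ c n)
    (hw : E.NormLE w C) (hwc : ∀ n, ∀ t ∈ Set.Ioo (0 : ℝ) ((1 / 2) ^ (n + 2)), c n ≤ w t) :
    ∃ C', E.NormLE F C' := by
  obtain ⟨v, hv, hwv⟩ := hw.aemeasurable
  have hvC : E.NormLE v C := hw.congr hwv.symm
  -- Eight disjoint translates of `(0, 1/8)` fit in `(0,1)`. Eight is the ratio of `2^{-n}`, an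
  -- upper bound for the measure of `{F > s}`, to `2^{-(n+3)}`, the length on which `w ≥ c (n+1)`.
  let I : Set ℝ := Set.Ioo 0 (1 / 8)
  let h : ℕ → ℝ → ℝ := fun i t => I.indicator v (t + -(i / 8))
  have hhm : ∀ i, Measurable (h i) := fun i =>
    (hv.indicator measurableSet_Ioo).comp (measurable_id.add_const _)
  have hh : ∀ i ∈ Finset.range 8, E.NormLE (h i) C := fun i _ =>
    hvC.of_distribution_le (hhm i).aemeasurable fun s hs => by
      calc vol01 {u | s < |h i u|} ≤ volume {u | s < |h i u|} := Measure.restrict_apply_le _ _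
        _ ≤ volume ((fun t : ℝ => t + -(i / 8)) ⁻¹' ({u | s < |v u|} ∩ Set.Ioo 0 1)) := by
          refine measure_mono fun u (hu : s < |h i u|) => ?_
          by_cases hI : u + -(i / 8) ∈ I
          · simp only [h] at hu
            rw [Set.indicator_of_mem hI] at hu
            exact ⟨hu, hI.1, hI.2.trans (by norm_num)⟩
          · simp only [h] at hu
            rw [Set.indicator_of_notMem hI, abs_zero] at hu
            exact absurd hu (not_lt.2 hs)
        _ = vol01 {u | s < |v u|} := by
          rw [measure_preimage_add_right, Measure.restrict_apply' measurableSet_Ioo]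
  -- The added constant `1` turns `s ≤ c (n+1) ≤ w` into the strict inequality needed for
  -- distribution functions.
  refine ⟨_, ((NormLE.sum _ hh).add hK).of_distribution_le hF.aemeasurable fun s hs => ?_⟩
  simp only [abs_of_nonneg (hF0 _)]
  by_cases h0 : vol01 {u | s < F u} = 0
  · rw [h0]; exact zero_le
  classical
  have hex := exists_half_pow_lt h0
  -- The least index is not zero, because no set has measure above `2^0 = 1`; minimality then bounds
  -- the measure of `{F > s}` by `2^{-n}`.
  obtain ⟨n, hn⟩ : ∃ n, Nat.find hex = n + 1 := Nat.exists_eq_succ_of_ne_zero fun hz => by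
    have := Nat.find_spec hex
    rw [hz, pow_zero, ENNReal.ofReal_one] at this
    exact absurd this (not_lt.2 (vol01_le_one _))
  have hspec := Nat.find_spec hex
  have hle : vol01 {u | s < F u} ≤ ENNReal.ofReal ((1 / 2) ^ n) :=
    not_lt.1 (Nat.find_min hex (m := n) (by omega))
  rw [hn] at hspec
  have hsc := hc _ _ hspec
  let A : Set ℝ := {t | s < v t + 1} ∩ I
  have hAm : MeasurableSet A :=
    (measurableSet_lt measurable_const (hv.add_const 1)).inter measurableSet_Ioo
  have hpow : ((1 : ℝ) / 2) ^ (n + 1 + 2) = (1 / 2) ^ n / 8 := by ring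
  have hpow1 : ((1 : ℝ) / 2) ^ n ≤ 1 := pow_le_one₀ (by norm_num) (by norm_num)
  have hA : ENNReal.ofReal ((1 / 2) ^ (n + 1 + 2)) ≤ volume A := by
    have h1 : Set.Ioo (0 : ℝ) ((1 / 2) ^ (n + 1 + 2)) ⊆ I :=
      Set.Ioo_subset_Ioo le_rfl (by rw [hpow]; linarith)
    have h2 : I ⊆ Set.Ioo 0 1 := Set.Ioo_subset_Ioo le_rfl (by norm_num)
    calc ENNReal.ofReal ((1 / 2) ^ (n + 1 + 2))
        = vol01 (Set.Ioo (0 : ℝ) ((1 / 2) ^ (n + 1 + 2))) := by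
          rw [vol01_Ioo le_rfl (by rw [hpow]; linarith), sub_zero]
      _ ≤ vol01 A := measure_mono_ae (by
          filter_upwards [hwv] with t ht hmem
          refine ⟨?_, h1 hmem⟩
          change s < v t + 1
          have := hwc (n + 1) t hmem
          rw [ht] at this
          linarith)
      _ ≤ volume A := Measure.restrict_apply_le _ _
  let B : ℕ → Set ℝ := fun i => (fun t : ℝ => t + -(i / 8)) ⁻¹' A
  have hBm : ∀ i, MeasurableSet (B i) := fun i => hAm.preimage (measurable_id.add_const _)
  have huniq : ∀ {i j : ℕ} {t : ℝ}, t + -(i / 8) ∈ I → t + -(j / 8) ∈ I → i = j := by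
    intro i j t hi hj
    have h1 : (i : ℝ) < j + 1 := by linarith [hi.1, hj.2]
    have h2 : (j : ℝ) < i + 1 := by linarith [hi.2, hj.1]
    have h1' : i < j + 1 := by exact_mod_cast h1
    have h2' : j < i + 1 := by exact_mod_cast h2
    omega
  calc vol01 {u | s < F u} ≤ ENNReal.ofReal ((1 / 2) ^ n) := hle
    _ = ∑ i ∈ Finset.range 8, ENNReal.ofReal ((1 / 2) ^ (n + 1 + 2)) := by
        rw [Finset.sum_const, Finset.card_range, nsmul_eq_mul, hpow,
          ← ENNReal.ofReal_natCast, ← ENNReal.ofReal_mul (by norm_num)]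
        congr 1
        push_cast
        ring
    _ ≤ ∑ i ∈ Finset.range 8, vol01 (B i) := Finset.sum_le_sum fun i hi => by
        have hi8 : (i : ℝ) + 1 ≤ 8 := by exact_mod_cast Finset.mem_range.1 hi
        rw [Measure.restrict_apply (hBm i), Set.inter_eq_left.2, measure_preimage_add_right]
        · exact hA
        · intro t ht
          have h1 : 0 < t + -(i / 8 : ℝ) := ht.2.1
          have h2 : t + -(i / 8 : ℝ) < 1 / 8 := ht.2.2
          have h3 : (0 : ℝ) ≤ i := i.cast_nonneg
          exact ⟨by linarith, by linarith⟩
    _ = vol01 (⋃ i ∈ Finset.range 8, B i) := by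
        refine (measure_biUnion_finset (fun i _ j _ hij => ?_) fun i _ => hBm i).symm
        exact Set.disjoint_left.2 fun t hi hj => hij (huniq hi.2 hj.2)
    _ ≤ _ := measure_mono fun t ht => by
        simp only [Set.mem_iUnion] at ht
        obtain ⟨i, hi, ht⟩ := ht
        change s < |∑ i ∈ Finset.range 8, h i t + 1|
        rw [Finset.sum_eq_single_of_mem i hi fun j _ hj => Set.indicator_of_notMem
          (fun hmem => hj (huniq hmem ht.2)) _]
        rw [Set.indicator_of_mem ht.2]
        exact lt_of_lt_of_le ht.1 (le_abs_self _)

/-- Bounded functions dominated by the dyadic rearrangement of `F = sup g k` are uniformly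
bounded in `E`, when the `g k` are. -/
theorem NormLE.of_le_dyadic {g : ℕ → ℝ → ℝ} {F v : ℝ → ℝ} {c : ℕ → ℝ} {C : ℝ}
    (hg : ∀ k, E.NormLE (g k) C) (hgmono : Monotone g)
    (hgF : ∀ u q, q < F u → ∃ k, q < g k u)
    (hc : ∀ n s, 0 ≤ s → s < c n → ENNReal.ofReal ((1 / 2) ^ n) < vol01 {u | s < F u})
    (hv : AEMeasurable v vol01) (N : ℕ) (hvN : ∀ t ∈ Set.Ioo (0 : ℝ) 1, |v t| ≤ c N)
    (hvc : ∀ n, ∀ t ∈ Set.Ioo (0 : ℝ) 1, (1 / 2) ^ (n + 1) ≤ t → |v t| ≤ c n) :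
    E.NormLE v (2 * C) := by
  -- Halving the level leaves room: `{F > c n / 2}` has measure above `2^{-n}`, and continuity from
  -- below passes this to a single `g k`. This is the source of the factor `2` in the bound.
  have hk : ∀ n, ∃ k, 0 < c n → ENNReal.ofReal ((1 / 2) ^ n) < vol01 {u | c n / 2 < g k u} := by
    intro n
    by_cases hn : 0 < c n
    · have h1 := hc n (c n / 2) (by linarith) (by linarith)
      have h2 : vol01 {u | c n / 2 < F u} ≤ ⨆ k, vol01 {u | c n / 2 < g k u} := by
        rw [← Monotone.measure_iUnion (s := fun k => {u | c n / 2 < g k u})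
          fun k l h u (hu : _ < g k u) => lt_of_lt_of_le hu (hgmono h u)]
        refine measure_mono fun u hu => ?_
        simpa using hgF u _ hu
      obtain ⟨k, hk⟩ := lt_iSup_iff.1 (h1.trans_le h2)
      exact ⟨k, fun _ => hk⟩
    · exact ⟨0, fun h => absurd h hn⟩
  choose k hk using hk
  let M := (Finset.range (N + 1)).sup k
  refine ((hg M).const_mul (r := 2) (by norm_num)).of_distribution_le hv fun s hs => ?_
  by_cases hsN : c N ≤ s
  · refine le_of_eq_of_le ?_ zero_le
    have : ∀ᵐ u ∂vol01, ¬ s < |v u| := by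
      rw [ae_restrict_iff' measurableSet_Ioo]
      exact Eventually.of_forall fun u hu => not_lt.2 ((hvN u hu).trans hsN)
    rw [ae_iff] at this
    simpa using this
  · classical
    have hex : ∃ n, s < c n := ⟨N, not_le.1 hsN⟩
    set n := Nat.find hex with hn
    have hspec : s < c n := Nat.find_spec hex
    have hnN : n ≤ N := Nat.find_min' hex (not_le.1 hsN)
    -- For `u ≥ 2^{-n}` with `n > 0` one has `|v u| ≤ c (n-1) ≤ s` by minimality of `n`, so only `u
    -- < 2^{-n}` contribute.
    have hle : vol01 {u | s < |v u|} ≤ ENNReal.ofReal ((1 / 2) ^ n) := by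
      rcases Nat.eq_zero_or_pos n with h0 | hpos
      · rw [h0, pow_zero, ENNReal.ofReal_one]
        exact vol01_le_one _
      · obtain ⟨m, hm⟩ := Nat.exists_eq_succ_of_ne_zero hpos.ne'
        refine le_trans (measure_mono_ae ?_) vol01_Iio_le
        have : ∀ᵐ u ∂vol01, s < |v u| → u < (1 / 2) ^ n := by
          rw [ae_restrict_iff' measurableSet_Ioo]
          refine Eventually.of_forall fun u hu hlt => ?_
          by_contra hge
          have h1 := hvc m u hu (by rw [← Nat.succ_eq_add_one, ← hm]; exact not_lt.1 hge)
          have h2 : ¬ s < c m := Nat.find_min hex (by omega)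
          exact h2 (hlt.trans_le h1)
        exact this
    refine hle.trans ((hk n (hs.trans_lt hspec)).le.trans (measure_mono fun u hu => ?_))
    have h1 : g (k n) u ≤ g M u :=
      hgmono (Finset.le_sup (f := k) (Finset.mem_range.2 (Nat.lt_succ_of_le hnN))) u
    have h2 : c n / 2 < g (k n) u := hu
    change s < |2 * g M u|
    rw [abs_of_nonneg (by linarith)]
    linarith

/-- A nonnegative function which is, up to a constant, dominated by every multiple of the dyadic
rearrangement of `F = sup g k` belongs to `E`, when the `g k` are bounded in `E`. -/
theorem NormLE.of_le_const_add_dyadic {g : ℕ → ℝ → ℝ} {F w : ℝ → ℝ} {c : ℕ → ℝ} {C K : ℝ}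
    (hK : E.NormLE (fun _ => 1) K)
    (hg : ∀ k, E.NormLE (g k) C) (hgmono : Monotone g)
    (hgF : ∀ u q, q < F u → ∃ k, q < g k u)
    (hc0 : ∀ n, 0 ≤ c n) (hcunb : ∀ R, ∃ n, R < c n)
    (hc : ∀ n s, 0 ≤ s → s < c n → ENNReal.ofReal ((1 / 2) ^ n) < vol01 {u | s < F u})
    (hw : AEMeasurable w vol01) (hw0 : ∀ t ∈ Set.Ioo (0 : ℝ) 1, 0 ≤ w t)
    (hwc : ∀ ε : ℝ, 0 < ε → ∃ R, ∀ n, ∀ t ∈ Set.Ioo (0 : ℝ) 1, (1 / 2) ^ (n + 1) ≤ t →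
      w t ≤ R + ε * c n) :
    ∃ C', E.NormLE w C' := by
  have hC0 : 0 ≤ C := (hg 0).nonneg
  have hin : ∀ {p : ℝ → Prop}, (∀ t ∈ Set.Ioo (0 : ℝ) 1, p t) → ∀ᵐ t ∂vol01, p t := fun h => by
    rw [ae_restrict_iff' measurableSet_Ioo]
    exact Eventually.of_forall h
  have hWm : ∀ j : ℕ, AEMeasurable (fun t => min (w t) j) vol01 := fun j =>
    hw.min aemeasurable_const
  have hW : ∀ j : ℕ, E.NormLE (fun t => min (w t) j) (j * K) := fun j =>
    (hK.const_mul (r := j) j.cast_nonneg).of_abs_le (hWm j) (hin fun t ht => by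
      rw [mul_one, abs_of_nonneg (le_min (hw0 t ht) j.cast_nonneg), Nat.abs_cast]
      exact min_le_right _ _)
  choose u hu _ using hW
  -- Beyond the height `R`, the difference of two truncations is at most `ε * c n`. Divided by `ε`
  -- it falls under `NormLE.of_le_dyadic`, whose bound `2 * C` does not depend on the truncation
  -- heights.
  have hdiff : ∀ ε : ℝ, 0 < ε → ∃ N : ℕ, ∀ j ≥ N, ∀ i ≥ j, E.norm (u i - u j) ≤ ε * (2 * C) := by
    intro ε hε
    obtain ⟨R, hR⟩ := hwc ε hε
    obtain ⟨N, hN⟩ := exists_nat_ge R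
    refine ⟨N, fun j hj i hij => ?_⟩
    obtain ⟨L, hL⟩ := hcunb (ε⁻¹ * i)
    have hji : (j : ℝ) ≤ i := by exact_mod_cast hij
    have hRj : R ≤ j := hN.trans (by exact_mod_cast hj)
    have habs : ∀ t, 0 ≤ min (w t) i - min (w t) j := fun t =>
      sub_nonneg.2 (min_le_min_left _ hji)
    have hv := NormLE.of_le_dyadic (v := fun t => ε⁻¹ * (min (w t) i - min (w t) j)) hg hgmono
      hgF hc (((hWm i).sub (hWm j)).const_mul _) L (fun t ht => by
        rw [abs_of_nonneg (mul_nonneg (inv_nonneg.2 hε.le) (habs t))]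
        refine le_trans (mul_le_mul_of_nonneg_left ?_ (inv_nonneg.2 hε.le)) hL.le
        have h1 : 0 ≤ min (w t) j := le_min (hw0 t ht) j.cast_nonneg
        linarith [min_le_right (w t) i]) (fun n t ht hn => by
        rw [abs_of_nonneg (mul_nonneg (inv_nonneg.2 hε.le) (habs t)), inv_mul_le_iff₀ hε]
        rcases le_total (w t) j with h | h
        · rw [min_eq_left h, min_eq_left (h.trans hji), sub_self]
          exact mul_nonneg hε.le (hc0 n)
        · rw [min_eq_right h]
          linarith [hR n t ht hn, min_le_left (w t) i])
    refine norm_le_of_ae_eq ((hv.const_mul hε.le)) (u i - u j) ?_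
    filter_upwards [hu i, hu j, AEEqFun.coeFn_sub (u i : S01) (u j : S01)] with t h1 h2 h3
    rw [AddSubgroupClass.coe_sub, h3, Pi.sub_apply, h1, h2, mul_inv_cancel_left₀ hε.ne',
      Complex.ofReal_sub]
  obtain ⟨f, hf⟩ := E.complete u fun ε hε => by
    have hε' : 0 < ε / (2 * C + 1) := by positivity
    obtain ⟨N, hN⟩ := hdiff _ hε'
    have hlt : ε / (2 * C + 1) * (2 * C) < ε := by
      rw [div_mul_eq_mul_div, div_lt_iff₀ (by positivity)]
      nlinarith
    refine ⟨N, fun m hm n hn => ?_⟩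
    rcases le_total n m with h | h
    · exact (hN n hn m h).trans_lt hlt
    · rw [map_sub_rev E.norm]
      exact (hN m hm n h).trans_lt hlt
  refine ⟨E.norm f, f, ?_, le_rfl⟩
  -- Norm convergence implies convergence in measure, and so does the pointwise stabilization of the
  -- truncations; uniqueness of the limit gives `f = w`.
  have hmeas1 : TendstoInMeasure vol01 (fun n t => (u n : S01) t) atTop (f : S01) := by
    rw [tendstoInMeasure_iff_norm]
    intro s hs
    rw [ENNReal.tendsto_nhds_zero]
    intro η hη
    obtain ⟨η', hη'0, hη'⟩ := ENNReal.lt_iff_exists_nnreal_btwn.1 hη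
    obtain ⟨κ, hκ, hκ'⟩ := exists_mul_le_of_le_distribution hK (η := η') (by exact_mod_cast hη'0)
    filter_upwards [hf.eventually (gt_mem_nhds (show 0 < s / 2 * κ by positivity))] with n hn
    by_contra hlt
    have h1 := hκ' _ _ (s / 2) (normLE_norm (u n - f)) (by linarith) (by
      rw [ENNReal.ofReal_coe_nnreal]
      refine hη'.le.trans ((not_le.1 hlt).le.trans (measure_mono_ae ?_))
      filter_upwards [AEEqFun.coeFn_sub (u n : S01) (f : S01)] with t ht
        (hst : s ≤ ‖(u n : S01) t - (f : S01) t‖)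
      change s / 2 < |‖((u n - f : E.carrier) : S01) t‖|
      rw [AddSubgroupClass.coe_sub, ht, Pi.sub_apply, abs_norm]
      linarith)
    linarith
  have hmeas2 : TendstoInMeasure vol01 (fun n t => (u n : S01) t) atTop
      (fun t => (w t : ℂ)) := by
    refine tendstoInMeasure_of_tendsto_ae (fun n => (u n : S01).aestronglyMeasurable) ?_
    filter_upwards [ae_all_iff.2 hu] with t ht
    obtain ⟨N, hN⟩ := exists_nat_ge (w t)
    refine tendsto_const_nhds.congr' ?_
    filter_upwards [eventually_ge_atTop N] with n hn
    rw [ht n, min_eq_left (hN.trans (by exact_mod_cast hn))]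
  exact tendstoInMeasure_ae_unique hmeas1 hmeas2

/-- For a space `E` without the Levi property there are coefficients `c n` such that step functions
comparable with `c n` on the `n`-th dyadic interval are outside of `E`, while those which are
negligible compared to them are in `E`. -/
theorem exists_coefficients (hE : ¬ E.HasLevi) :
    ∃ c : ℕ → ℝ, (∀ n, 0 ≤ c n) ∧ Monotone c ∧
      (∀ w : ℝ → ℝ, AEMeasurable w vol01 → (∀ t ∈ Set.Ioo (0 : ℝ) 1, 0 ≤ w t) →
        (∀ ε : ℝ, 0 < ε → ∃ R, ∀ n, ∀ t ∈ Set.Ioo (0 : ℝ) 1, (1 / 2) ^ (n + 1) ≤ t →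
          w t ≤ R + ε * c n) → ∃ C, E.NormLE w C) ∧
      ∀ w : ℝ → ℝ, (∀ n, ∀ t ∈ Set.Ioo (0 : ℝ) ((1 / 2) ^ (n + 2)), c n ≤ w t) →
        ∀ C, ¬ E.NormLE w C := by
  obtain ⟨g, F, C, K, hK, hg, hgmono, hFm, hF0, hgF, hFE⟩ := exists_seq_of_not_hasLevi hE
  obtain ⟨c, hc0, hcmono, hc1, hc2⟩ := exists_dyadic_rearrangement hFm hF0
  -- Otherwise `F` would be essentially bounded, hence in `E`.
  have hcunb : ∀ R, ∃ n, R < c n := by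
    intro R
    by_contra hc
    push Not at hc
    have hR0 : 0 ≤ R := (hc0 0).trans (hc 0)
    refine hFE _ ((hK.const_mul (r := R + 1) (by linarith)).of_abs_le hFm.aemeasurable ?_)
    have h0 : vol01 {u | R + 1 < F u} = 0 := by
      by_contra h0
      obtain ⟨n, hn⟩ := exists_half_pow_lt h0
      linarith [hc2 n _ hn, hc n]
    have h1 : ∀ᵐ u ∂vol01, ¬ R + 1 < F u := by
      rw [ae_iff]
      simpa using h0
    filter_upwards [h1] with u hu
    rw [mul_one, abs_of_nonneg (hF0 u), abs_of_nonneg (by linarith)]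
    exact not_lt.1 hu
  refine ⟨c, hc0, hcmono, fun w hw hw0 hwc => NormLE.of_le_const_add_dyadic hK hg hgmono hgF
    hc0 hcunb hc1 hw hw0 hwc, fun w hwc C' hw => ?_⟩
  obtain ⟨C'', h⟩ := NormLE.of_dyadic_le hFm hF0 hK hc2 hw hwc
  exact hFE _ h

end SymmetricFunctionSpace

/-! ### Coordinates in the Hilbert direct sum -/

/-- The Hilbert space `ℂ²` on which the blocks act. -/
abbrev C2 : Type := EuclideanSpace ℂ (Fin 2)

theorem continuous_coord (n : ℕ) : Continuous fun ξ : HS => ξ n :=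
  (lp.evalCLM ℂ (fun _ : ℕ => C2) 2 n).continuous

theorem norm_coord_le (ξ : HS) (n : ℕ) : ‖ξ n‖ ≤ ‖ξ‖ := lp.norm_apply_le_norm two_ne_zero ξ n

theorem tendsto_sum_single (ξ : HS) :
    Tendsto (fun N => ∑ n ∈ Finset.range N, lp.single 2 n (ξ n)) atTop (𝓝 ξ) :=
  (lp.hasSum_single ENNReal.ofNat_ne_top ξ).tendsto_sum_nat

/-- A square summable bound on the coordinates. -/
theorem memℓp_of_norm_le (ξ : HS) {c : ℝ} {f : ℕ → C2} (h : ∀ n, ‖f n‖ ≤ c * ‖ξ n‖) :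
    Memℓp f 2 :=
  ((lp.memℓp ξ).norm.const_mul c).mono h

theorem norm_le_mul_norm {ξ η : HS} {c : ℝ} (hc : 0 ≤ c) (h : ∀ n, ‖η n‖ ≤ c * ‖ξ n‖) :
    ‖η‖ ≤ c * ‖ξ‖ := by
  have := lp.norm_mono two_ne_zero (x := η) (y := (c : ℂ) • ξ) fun n => by
    rw [lp.coeFn_smul, Pi.smul_apply, norm_smul, Complex.norm_real, Real.norm_of_nonneg hc]
    exact h n
  rwa [norm_smul, Complex.norm_real, Real.norm_of_nonneg hc] at this

/-! ### Unbounded block diagonal operators -/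

/-- The block diagonal operator with blocks `d n`, on its maximal domain. -/
def blockOp (d : ℕ → C2 →L[ℂ] C2) : HS →ₗ.[ℂ] HS where
  domain :=
    { carrier := {ξ | Memℓp (fun n => d n (ξ n)) 2}
      zero_mem' := by
        change Memℓp (fun n => d n ((0 : HS) n)) 2
        rw [show (fun n => d n ((0 : HS) n)) = 0 from funext fun n => by simp]
        exact zero_memℓp
      add_mem' := fun {ξ η} hξ hη => by
        simpa [Pi.add_def] using Memℓp.add hξ hη
      smul_mem' := fun c ξ hξ => by
        simpa [Pi.smul_def] using Memℓp.const_smul hξ c }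
  toFun :=
    { toFun := fun ξ => ⟨fun n => d n ((ξ : HS) n), ξ.2⟩
      map_add' := fun ξ η => by ext1; funext n; exact map_add (d n) _ _
      map_smul' := fun c ξ => by ext1; funext n; exact map_smul (d n) _ _ }

variable {d e : ℕ → C2 →L[ℂ] C2}

theorem mem_blockOp_domain {ξ : HS} : ξ ∈ (blockOp d).domain ↔ Memℓp (fun n => d n (ξ n)) 2 :=
  Iff.rfl

@[simp]
theorem blockOp_apply (ξ : (blockOp d).domain) (n : ℕ) : (blockOp d ξ) n = d n ((ξ : HS) n) := rfl

theorem mem_graph_blockOp {p : HS × HS} : p ∈ (blockOp d).graph ↔ ∀ n, p.2 n = d n (p.1 n) := by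
  rw [LinearPMap.mem_graph_iff]
  constructor
  · rintro ⟨ξ, h1, h2⟩ n
    rw [← h1, ← h2, blockOp_apply]
  · intro h
    refine ⟨⟨p.1, ?_⟩, rfl, ?_⟩
    · rw [mem_blockOp_domain, ← funext h]
      exact lp.memℓp p.2
    · ext1
      funext n
      rw [blockOp_apply, h]

theorem single_mem_graph_blockOp (d : ℕ → C2 →L[ℂ] C2) (n : ℕ) (v : C2) :
    ((lp.single 2 n v : HS), (lp.single 2 n (d n v) : HS)) ∈ (blockOp d).graph := by
  rw [mem_graph_blockOp]
  intro k
  by_cases hk : k = n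
  · subst hk; simp
  · simp [Pi.single_eq_of_ne hk]

theorem single_mem_blockOp_domain (d : ℕ → C2 →L[ℂ] C2) (n : ℕ) (v : C2) :
    (lp.single 2 n v : HS) ∈ (blockOp d).domain :=
  LinearPMap.mem_domain_of_mem_graph (single_mem_graph_blockOp d n v)

theorem blockOp_single (n : ℕ) (v : C2) (h : (lp.single 2 n v : HS) ∈ (blockOp d).domain) :
    blockOp d ⟨lp.single 2 n v, h⟩ = lp.single 2 n (d n v) :=
  ((LinearPMap.image_iff h).2 (single_mem_graph_blockOp d n v)).symm

theorem blockOp_injective : Function.Injective blockOp := by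
  intro d e h
  funext n
  ext1 v
  have h1 := single_mem_graph_blockOp d n v
  rw [h] at h1
  have h2 := LinearPMap.mem_graph_snd_inj _ h1 (single_mem_graph_blockOp e n v) rfl
  have h3 := congrArg (fun ξ : HS => ξ n) h2
  simpa using h3

theorem isClosed_blockOp (d : ℕ → C2 →L[ℂ] C2) : (blockOp d).IsClosed := by
  have : ((blockOp d).graph : Set (HS × HS)) = ⋂ n, {p | p.2 n = d n (p.1 n)} := by
    ext p
    rw [Set.mem_iInter]
    exact mem_graph_blockOp
  rw [LinearPMap.IsClosed, this]
  exact isClosed_iInter fun n => isClosed_eq ((continuous_coord n).comp continuous_snd)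
    ((d n).continuous.comp ((continuous_coord n).comp continuous_fst))

/-- Finitely supported sequences are a core for a block diagonal operator. -/
theorem closure_eq_blockOp {T : HS →ₗ.[ℂ] HS} (h : ∀ (ξ : T.domain) n, (T ξ) n = d n ((ξ : HS) n))
    (hs : ∀ n v, (lp.single 2 n v : HS) ∈ T.domain) : T.closure = blockOp d := by
  have hle : T.graph ≤ (blockOp d).graph := fun p hp => by
    rw [LinearPMap.mem_graph_iff] at hp
    obtain ⟨ξ, h1, h2⟩ := hp
    rw [mem_graph_blockOp]
    intro n
    rw [← h1, ← h2, h]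
  have hcl : T.IsClosable :=
    (isClosed_blockOp d).isClosable.leIsClosable (LinearPMap.le_of_le_graph hle)
  refine LinearPMap.eq_of_eq_graph ?_
  rw [← hcl.graph_closure_eq_closure_graph]
  refine le_antisymm (Submodule.topologicalClosure_minimal _ hle (isClosed_blockOp d)) ?_
  rintro ⟨ξ, η⟩ hp
  rw [mem_graph_blockOp] at hp
  have hsingle : ∀ n, ((lp.single 2 n (ξ n) : HS), (lp.single 2 n (η n) : HS)) ∈ T.graph := by
    intro n
    have h1 := T.mem_graph ⟨_, hs n (ξ n)⟩
    have h2 := LinearPMap.mem_graph_snd_inj _ (hle h1) (single_mem_graph_blockOp d n (ξ n)) rfl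
    have h3 : η n = d n (ξ n) := hp n
    rw [h3, ← h2]
    exact h1
  refine mem_closure_of_tendsto ((tendsto_sum_single ξ).prodMk_nhds (tendsto_sum_single η))
    (Eventually.of_forall fun N => ?_)
  have h4 := Submodule.sum_mem _ fun n (_ : n ∈ Finset.range N) => hsingle n
  change (_, _) ∈ T.graph
  convert h4 using 1
  exact Prod.ext (by rw [Prod.fst_sum]) (by rw [Prod.snd_sum])

theorem strongAdd_blockOp (d e : ℕ → C2 →L[ℂ] C2) :
    strongAdd (blockOp d) (blockOp e) = blockOp fun n => d n + e n := by
  refine closure_eq_blockOp (fun ξ n => ?_) fun n v =>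
    ⟨single_mem_blockOp_domain d n v, single_mem_blockOp_domain e n v⟩
  rw [LinearPMap.add_apply]
  rfl

theorem strongSub_blockOp (d e : ℕ → C2 →L[ℂ] C2) :
    strongSub (blockOp d) (blockOp e) = blockOp fun n => d n - e n := by
  refine closure_eq_blockOp (fun ξ n => ?_) fun n v =>
    ⟨single_mem_blockOp_domain d n v, single_mem_blockOp_domain e n v⟩
  rw [LinearPMap.sub_apply]
  rfl

theorem strongSMul_blockOp (c : ℂ) (d : ℕ → C2 →L[ℂ] C2) :
    strongSMul c (blockOp d) = blockOp fun n => c • d n :=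
  closure_eq_blockOp (fun _ _ => rfl) fun n v => single_mem_blockOp_domain d n v

theorem strongMul_blockOp (d e : ℕ → C2 →L[ℂ] C2) :
    strongMul (blockOp d) (blockOp e) = blockOp fun n => d n * e n := by
  refine closure_eq_blockOp (fun ξ n => rfl) fun n v => ?_
  refine ⟨⟨⟨lp.single 2 n v, single_mem_blockOp_domain e n v⟩, ?_, rfl⟩,
    single_mem_blockOp_domain e n v⟩
  change blockOp e ⟨lp.single 2 n v, _⟩ ∈ (blockOp d).domain
  rw [blockOp_single]
  exact single_mem_blockOp_domain d n _

theorem dense_blockOp_domain (d : ℕ → C2 →L[ℂ] C2) : Dense ((blockOp d).domain : Set HS) :=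
  fun ξ => mem_closure_of_tendsto (tendsto_sum_single ξ) (Eventually.of_forall fun _ =>
    Submodule.sum_mem _ fun n _ => single_mem_blockOp_domain d n _)

/-! ### Central diagonal projections -/

open Classical in
/-- The projection onto the blocks with index in `s`. -/
def diagProj (s : Set ℕ) : HS →L[ℂ] HS :=
  LinearMap.mkContinuous
    { toFun := fun ξ => ⟨fun n => if n ∈ s then ξ n else 0, memℓp_of_norm_le ξ (c := 1) fun n => by
        split_ifs <;> simp⟩
      map_add' := fun ξ η => by
        ext1; funext n
        change (if n ∈ s then ξ n + η n else 0)
          = (if n ∈ s then ξ n else 0) + if n ∈ s then η n else 0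
        by_cases hn : n ∈ s <;> simp [hn]
      map_smul' := fun c ξ => by
        ext1; funext n
        by_cases hn : n ∈ s <;> simp [hn] } 1
    fun ξ => norm_le_mul_norm zero_le_one fun n => by
      by_cases hn : n ∈ s <;> simp [hn]

open Classical in
theorem diagProj_apply (s : Set ℕ) (ξ : HS) (n : ℕ) :
    (diagProj s ξ) n = if n ∈ s then ξ n else 0 := rfl

theorem diagProj_apply_of_mem {s : Set ℕ} (ξ : HS) {n : ℕ} (hn : n ∈ s) :
    (diagProj s ξ) n = ξ n := by rw [diagProj_apply, if_pos hn]

theorem diagProj_apply_of_notMem {s : Set ℕ} (ξ : HS) {n : ℕ} (hn : n ∉ s) :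
    (diagProj s ξ) n = 0 := by rw [diagProj_apply, if_neg hn]

theorem HS.clm_ext {S T : HS →L[ℂ] HS} (h : ∀ ξ n, (S ξ) n = (T ξ) n) : S = T := by
  ext1 ξ
  ext1
  funext n
  exact h ξ n

theorem diagProj_mul (s t : Set ℕ) : diagProj s * diagProj t = diagProj (s ∩ t) := by
  refine HS.clm_ext fun ξ n => ?_
  change (diagProj s (diagProj t ξ)) n = _
  by_cases hs : n ∈ s <;> by_cases ht : n ∈ t <;> simp [diagProj_apply, hs, ht]

theorem one_sub_diagProj (s : Set ℕ) : 1 - diagProj s = diagProj sᶜ := by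
  refine HS.clm_ext fun ξ n => ?_
  change ξ n - (diagProj s ξ) n = _
  by_cases hs : n ∈ s <;> simp [diagProj_apply, hs]

theorem isStarProjection_diagProj (s : Set ℕ) : IsStarProjection (diagProj s) := by
  refine ⟨by rw [IsIdempotentElem, diagProj_mul, Set.inter_self], ?_⟩
  rw [ContinuousLinearMap.isSelfAdjoint_iff_isSymmetric]
  intro ξ η
  rw [ContinuousLinearMap.coe_coe, lp.inner_eq_tsum, lp.inner_eq_tsum]
  refine tsum_congr fun n => ?_
  by_cases hn : n ∈ s <;> simp [diagProj_apply, hn]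

theorem diagProj_mono {s t : Set ℕ} (h : s ⊆ t) : diagProj s ≤ diagProj t := by
  rw [← sub_nonneg]
  have : diagProj t - diagProj s = diagProj (t \ s) := by
    refine HS.clm_ext fun ξ n => ?_
    change (diagProj t ξ) n - (diagProj s ξ) n = _
    by_cases hs : n ∈ s
    · simp [diagProj_apply, hs, h hs]
    · by_cases ht : n ∈ t <;> simp [diagProj_apply, hs, ht]
  rw [this]
  exact (isStarProjection_diagProj _).nonneg

theorem diagProj_singleton (n : ℕ) (ξ : HS) : diagProj {n} ξ = lp.single 2 n (ξ n) := by
  ext1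
  funext k
  by_cases hk : k = n
  · subst hk; simp [diagProj_apply]
  · simp [diagProj_apply, hk]

theorem diagProj_Iio (N : ℕ) (ξ : HS) :
    diagProj (Set.Iio N) ξ = ∑ n ∈ Finset.range N, lp.single 2 n (ξ n) := by
  ext1
  funext k
  rw [lp.coeFn_sum, Finset.sum_apply]
  by_cases hk : k < N
  · rw [Finset.sum_eq_single_of_mem k (Finset.mem_range.2 hk) fun j _ hj => by
      exact Pi.single_eq_of_ne hj.symm _]
    simp [diagProj_apply, hk]
  · rw [Finset.sum_eq_zero fun j hj => by
      exact Pi.single_eq_of_ne (by have := Finset.mem_range.1 hj; omega) _]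
    simp [diagProj_apply, hk]

theorem tendsto_diagProj_Iio (ξ : HS) :
    Tendsto (fun N => diagProj (Set.Iio N) ξ) atTop (𝓝 ξ) := by
  simp only [diagProj_Iio]
  exact tendsto_sum_single ξ

/-! ### The algebras -/

/-- The operator acting as `D` in block `n` and as zero in the others. -/
def singleBlock (n : ℕ) (D : C2 →L[ℂ] C2) : HS →L[ℂ] HS :=
  (lp.singleContinuousLinearMap ℂ (fun _ : ℕ => C2) 2 n) ∘L D ∘L
    (lp.evalCLM ℂ (fun _ : ℕ => C2) 2 n)

theorem singleBlock_apply (n : ℕ) (D : C2 →L[ℂ] C2) (ξ : HS) :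
    singleBlock n D ξ = lp.single 2 n (D (ξ n)) := rfl

theorem singleBlock_mem_algSum (n : ℕ) (D : C2 →L[ℂ] C2) : singleBlock n D ∈ algSum := by
  refine ⟨Pi.single n (Matrix.toEuclideanLin.symm D.toLinearMap),
    (Set.finite_singleton n).subset fun k hk => ?_, fun ξ k => ?_⟩
  · by_contra hne
    exact hk (Pi.single_eq_of_ne hne _)
  · rw [singleBlock_apply]
    by_cases hk : k = n
    · subst hk; simp
    · simp [Pi.single_eq_of_ne hk]

theorem algSum_subset_wotClosure {T : HS →L[ℂ] HS} (hT : T ∈ algSum) : T ∈ wotClosure :=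
  subset_closure ⟨T, hT, rfl⟩

theorem normClosure_subset_wotClosure {T : HS →L[ℂ] HS} (hT : T ∈ normClosure) :
    T ∈ wotClosure := by
  have h : T ∈ closure (algSum : Set (HS →L[ℂ] HS)) := hT
  exact image_closure_subset_closure_image ContinuousLinearMapWOT.continuous_ofCLM ⟨T, h, rfl⟩

/-- The `n`-th diagonal block, as an operator. -/
def blk (T : HS →L[ℂ] HS) (n : ℕ) : C2 →L[ℂ] C2 :=
  (lp.evalCLM ℂ (fun _ : ℕ => C2) 2 n) ∘L T ∘L
    (lp.singleContinuousLinearMap ℂ (fun _ : ℕ => C2) 2 n)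

theorem blk_apply (T : HS →L[ℂ] HS) (n : ℕ) (v : C2) : blk T n v = (T (lp.single 2 n v)) n := rfl

theorem norm_blk_le (T : HS →L[ℂ] HS) (n : ℕ) : ‖blk T n‖ ≤ ‖T‖ := by
  refine ContinuousLinearMap.opNorm_le_bound _ (norm_nonneg _) fun v => ?_
  rw [blk_apply]
  refine (norm_coord_le _ n).trans ((T.le_opNorm _).trans_eq ?_)
  rw [lp.norm_single two_pos]

theorem blk_add (S T : HS →L[ℂ] HS) (n : ℕ) : blk (S + T) n = blk S n + blk T n := rfl

theorem blk_sub (S T : HS →L[ℂ] HS) (n : ℕ) : blk (S - T) n = blk S n - blk T n := rfl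

theorem blk_smul (c : ℂ) (T : HS →L[ℂ] HS) (n : ℕ) : blk (c • T) n = c • blk T n := rfl

/-- For fixed `ξ`, `n` and coordinate `i`, this is an equality of two functionals continuous in the
weak operator topology. It therefore passes from `algSum` to the closure. -/
theorem apply_coord_of_mem {T : HS →L[ℂ] HS} (hT : T ∈ wotClosure) (ξ : HS) (n : ℕ) :
    (T ξ) n = blk T n (ξ n) := by
  rw [blk_apply]
  ext i
  let y : StrongDual ℂ HS := (EuclideanSpace.proj i) ∘L (lp.evalCLM ℂ (fun _ : ℕ => C2) 2 n)
  have hcl : IsClosed {A : HS →WOT[ℂ] HS | y (A ξ) = y (A (lp.single 2 n (ξ n)))} :=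
    isClosed_eq (ContinuousLinearMapWOT.continuous_dual_apply ξ y)
      (ContinuousLinearMapWOT.continuous_dual_apply _ y)
  refine closure_minimal ?_ hcl hT
  rintro _ ⟨S, ⟨m, -, hS⟩, rfl⟩
  change (S ξ) n i = (S (lp.single 2 n (ξ n))) n i
  rw [hS, hS, lp.single_apply_self]

theorem apply_single_of_mem {T : HS →L[ℂ] HS} (hT : T ∈ wotClosure) (n : ℕ) (v : C2) :
    T (lp.single 2 n v) = lp.single 2 n (blk T n v) := by
  ext1
  funext k
  rw [apply_coord_of_mem hT]
  by_cases hk : k = n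
  · subst hk; simp
  · simp [Pi.single_eq_of_ne hk]

theorem blk_mul {S T : HS →L[ℂ] HS} (hT : T ∈ wotClosure) (n : ℕ) :
    blk (S * T) n = blk S n * blk T n := by
  ext1 v
  change (S (T (lp.single 2 n v))) n = (S (lp.single 2 n (blk T n v))) n
  rw [apply_single_of_mem hT]

theorem ofBounded_eq_blockOp {T : HS →L[ℂ] HS} (hT : T ∈ wotClosure) :
    ofBounded T = blockOp (blk T) := by
  refine LinearPMap.eq_of_eq_graph (Submodule.ext fun p => ?_)
  rw [mem_graph_blockOp, LinearPMap.mem_graph_iff]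
  constructor
  · rintro ⟨ξ, h1, h2⟩ n
    rw [← h1, ← h2]
    exact apply_coord_of_mem hT _ n
  · intro h
    refine ⟨⟨p.1, trivial⟩, rfl, ?_⟩
    ext1
    funext n
    rw [h]
    exact apply_coord_of_mem hT _ n

/-- Passing to a block is contractive, and an approximant in `algSum` has only finitely many nonzero
blocks. This decay is what separates the norm closure from the von Neumann algebra in the argument.
-/
theorem tendsto_norm_blk {T : HS →L[ℂ] HS} (hT : T ∈ normClosure) :
    Tendsto (fun n => ‖blk T n‖) atTop (𝓝 0) := by
  have h : T ∈ closure (algSum : Set (HS →L[ℂ] HS)) := hT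
  rw [Metric.tendsto_atTop]
  intro ε hε
  obtain ⟨S, ⟨m, hm, hS⟩, hd⟩ := Metric.mem_closure_iff.1 h ε hε
  obtain ⟨N, hN⟩ := hm.bddAbove
  refine ⟨N + 1, fun n hn => ?_⟩
  have hmn : m n = 0 := by
    by_contra hne
    have : n ≤ N := hN hne
    omega
  have hSn : blk S n = 0 := by
    ext1 v
    rw [blk_apply, hS, hmn]
    simp
  rw [dist_zero_right, norm_norm]
  calc ‖blk T n‖ = ‖blk (T - S) n‖ := by rw [blk_sub, hSn, sub_zero]
    _ ≤ ‖T - S‖ := norm_blk_le _ _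
    _ < ε := by rwa [← dist_eq_norm]

/-- The truncations to the first `N` blocks lie in `algSum` and converge strongly, hence weakly. -/
theorem diagProj_mem_wotClosure (s : Set ℕ) : diagProj s ∈ wotClosure := by
  have hfin : ∀ N, diagProj (Set.Iio N) * diagProj s ∈ algSum := fun N => by
    have : diagProj (Set.Iio N) * diagProj s
        = ∑ n ∈ Finset.range N, singleBlock n (blk (diagProj s) n) := by
      ext1 ξ
      change diagProj (Set.Iio N) (diagProj s ξ) = _
      rw [diagProj_Iio, sum_apply]
      refine Finset.sum_congr rfl fun n _ => ?_
      rw [singleBlock_apply, blk_apply]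
      by_cases hn : n ∈ s <;> simp [diagProj_apply, hn]
    rw [this]
    exact sum_mem fun n _ => singleBlock_mem_algSum n _
  refine mem_closure_of_tendsto (f := fun N => ContinuousLinearMapWOT.ofCLM
    (diagProj (Set.Iio N) * diagProj s)) (b := atTop) ?_
    (Eventually.of_forall fun N => ⟨_, hfin N, rfl⟩)
  rw [ContinuousLinearMapWOT.tendsto_iff_forall_dual_apply_tendsto]
  exact fun ξ y => (y.continuous.tendsto _).comp (tendsto_diagProj_Iio (diagProj s ξ))

theorem isProj_diagProj (s : Set ℕ) : IsProj wotClosure (diagProj s) :=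
  ⟨diagProj_mem_wotClosure s, isStarProjection_diagProj s⟩

theorem commute_diagProj_singleton {T : HS →L[ℂ] HS} (hT : T ∈ wotClosure) (n : ℕ) :
    Commute T (diagProj {n}) := by
  ext1 ξ
  change T (diagProj {n} ξ) = diagProj {n} (T ξ)
  rw [diagProj_singleton, diagProj_singleton, apply_single_of_mem hT, apply_coord_of_mem hT]

/-! ### Affiliated operators -/

/-- An operator in the commutant commutes with the projection onto block `n` and with the bounded
operator `singleBlock n (d n)`; together these give the coordinatewise graph condition. -/
theorem isAffiliated_blockOp (d : ℕ → C2 →L[ℂ] C2) : IsAffiliated wotClosure (blockOp d) := by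
  refine ⟨isClosed_blockOp d, dense_blockOp_domain d, fun y hy ξ => ?_⟩
  have hcomm : ∀ T ∈ wotClosure, ∀ η, T (y η) = y (T η) := fun T hT η =>
    congrArg (fun S : HS →L[ℂ] HS => S η) (hy T hT)
  have hcoord : ∀ n, (y (blockOp d ξ)) n = d n ((y ξ) n) := fun n => by
    have h1 := hcomm _ (diagProj_mem_wotClosure {n}) (blockOp d ξ)
    have h2 := hcomm _ (algSum_subset_wotClosure (singleBlock_mem_algSum n (d n))) ξ
    rw [diagProj_singleton, diagProj_singleton, blockOp_apply] at h1
    rw [singleBlock_apply, singleBlock_apply, ← h1] at h2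
    have h3 := congrArg (fun η : HS => η n) h2
    simpa using h3.symm
  have hmem : ((y ξ : HS), y (blockOp d ξ)) ∈ (blockOp d).graph := mem_graph_blockOp.2 hcoord
  have hdom := LinearPMap.mem_domain_of_mem_graph hmem
  exact ⟨hdom, ((LinearPMap.image_iff hdom).2 hmem).symm⟩

/-- Every operator affiliated with `⊕ M₂` is block diagonal. -/
theorem IsAffiliated.exists_eq_blockOp {x : HS →ₗ.[ℂ] HS} (hx : IsAffiliated wotClosure x) :
    ∃ d, x = blockOp d := by
  obtain ⟨hcl, hdense, hcomm⟩ := hx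
  -- The block projections are central, so they lie in the commutant and affiliation makes them
  -- preserve the domain.
  have hP : ∀ n (ξ : x.domain), ∃ h : (lp.single 2 n ((ξ : HS) n) : HS) ∈ x.domain,
      x ⟨_, h⟩ = lp.single 2 n ((x ξ) n) := fun n ξ => by
    obtain ⟨h, h'⟩ := hcomm (diagProj {n})
      (fun T hT => (commute_diagProj_singleton hT n).eq) ξ
    simp only [diagProj_singleton] at h h'
    exact ⟨h, h'⟩
  let W : ℕ → Submodule ℂ C2 := fun n => x.domain.comap
    (lp.lsingle (𝕜 := ℂ) (E := fun _ : ℕ => C2) 2 n)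
  -- The vectors of block `n` in the domain form a dense subspace of `ℂ²`, which is everything in
  -- finite dimension.
  have hW : ∀ n v, (lp.single 2 n v : HS) ∈ x.domain := fun n v => by
    have hcl : IsClosed (W n : Set C2) := Submodule.closed_of_finiteDimensional _
    have hd : Dense (W n : Set C2) := by
      intro v
      have h1 : v ∈ (fun ξ : HS => ξ n) '' closure (x.domain : Set HS) :=
        ⟨lp.single 2 n v, hdense _, by simp⟩
      refine closure_mono ?_ (image_closure_subset_closure_image (continuous_coord n) h1)
      rintro _ ⟨ξ, hξ, rfl⟩
      exact (hP n ⟨ξ, hξ⟩).1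
    have : v ∈ (W n : Set C2) := by
      rw [← hcl.closure_eq]
      exact hd v
    exact this
  let d : ℕ → C2 →L[ℂ] C2 := fun n => LinearMap.toContinuousLinearMap
    { toFun := fun v => (x ⟨lp.single 2 n v, hW n v⟩) n
      map_add' := fun v w => by
        have : (⟨lp.single 2 n (v + w), hW n (v + w)⟩ : x.domain)
            = ⟨lp.single 2 n v, hW n v⟩ + ⟨lp.single 2 n w, hW n w⟩ :=
          Subtype.ext (lp.single_add (E := fun _ : ℕ => C2) 2 n v w)
        rw [this, x.map_add]
        rfl
      map_smul' := fun c v => by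
        have : (⟨lp.single 2 n (c • v), hW n (c • v)⟩ : x.domain)
            = c • ⟨lp.single 2 n v, hW n v⟩ :=
          Subtype.ext (lp.single_smul (E := fun _ : ℕ => C2) 2 n c v)
        rw [this, x.map_smul]
        rfl }
  refine ⟨d, ?_⟩
  have h : x.closure = blockOp d := closure_eq_blockOp (fun ξ n => by
    obtain ⟨h1, h2⟩ := hP n ξ
    change (x ξ) n = (x ⟨lp.single 2 n ((ξ : HS) n), _⟩) n
    rw [h2, lp.single_apply_self]) hW
  rw [← h]
  refine LinearPMap.eq_of_eq_graph ?_
  rw [← hcl.isClosable.graph_closure_eq_closure_graph]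
  exact (IsClosed.submodule_topologicalClosure_eq hcl).symm

/-- The coordinates in block `n` of the values of an operator commuting with the block
projections. -/
theorem apply_single_of_commute {T : HS →L[ℂ] HS} {n : ℕ} (hT : Commute T (diagProj {n}))
    (v : C2) : T (lp.single 2 n v) = lp.single 2 n (blk T n v) := by
  have h := congrArg (fun S : HS →L[ℂ] HS => S (lp.single 2 n v)) hT.eq
  change T (diagProj {n} (lp.single 2 n v)) = diagProj {n} (T (lp.single 2 n v)) at h
  rw [diagProj_singleton, diagProj_singleton, lp.single_apply_self] at h
  exact h

/-- Each block is finite dimensional, so a left inverse is a right inverse there: `v* v = 1` in a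
block forces `v v* = 1`. -/
theorem isFiniteProj_diagProj (s : Set ℕ) : IsFiniteProj wotClosure (diagProj s) := by
  refine ⟨isProj_diagProj s, fun v hv hvv _ => ?_⟩
  have hc : ∀ n, Commute v (diagProj {n}) := commute_diagProj_singleton hv
  have hc' : ∀ n, Commute (star v) (diagProj {n}) := fun n => by
    have h := (hc n).star_star
    rwa [(isStarProjection_diagProj {n}).isSelfAdjoint.star_eq] at h
  have happ : ∀ ξ, star v (v ξ) = diagProj s ξ := fun ξ =>
    congrArg (fun S : HS →L[ℂ] HS => S ξ) hvv
  refine lp.ext_continuousLinearMap (by norm_num) fun n => ?_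
  ext1 w
  change v (star v (lp.single 2 n w)) = diagProj s (lp.single 2 n w)
  rw [apply_single_of_commute (hc' n), apply_single_of_commute (hc n)]
  have hsv : ∀ w, diagProj s (lp.single 2 n w) = lp.single 2 n (blk (star v) n (blk v n w)) :=
    fun w => by
      rw [← happ, apply_single_of_commute (hc n), apply_single_of_commute (hc' n)]
  by_cases hn : n ∈ s
  · have hs : ∀ w : C2, diagProj s (lp.single 2 n w) = (lp.single 2 n w : HS) := fun w => by
      ext1
      funext k
      by_cases hk : k = n
      · subst hk; rw [diagProj_apply_of_mem _ hn]
      · simp [diagProj_apply, Pi.single_eq_of_ne hk]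
    have h1 : (blk (star v) n).toLinearMap * (blk v n).toLinearMap = 1 := by
      ext1 w
      have h2 := congrArg (fun η : HS => η n) ((hs w).symm.trans (hsv w))
      simpa using h2.symm
    have h2 : (blk v n).toLinearMap * (blk (star v) n).toLinearMap = 1 := mul_eq_one_comm.1 h1
    have h3 : blk v n (blk (star v) n w) = w := congrArg (fun L : C2 →ₗ[ℂ] C2 => L w) h2
    rw [h3, hs]
  · have hs : ∀ w : C2, diagProj s (lp.single 2 n w) = (0 : HS) := fun w => by
      ext1
      funext k
      by_cases hk : k = n
      · subst hk; rw [diagProj_apply_of_notMem _ hn]; rfl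
      · simp [diagProj_apply, Pi.single_eq_of_ne hk]
    -- Off `s` the squared norm `⟨v* v w, w⟩` vanishes.
    have h1 : ∀ w : C2, v (lp.single 2 n w) = 0 := fun w => by
      rw [← inner_self_eq_zero (𝕜 := ℂ), ← ContinuousLinearMap.adjoint_inner_left]
      change inner ℂ (star v (v (lp.single 2 n w))) _ = (0 : ℂ)
      rw [happ, hs, inner_zero_left]
    have h2 : ∀ w : C2, blk v n w = 0 := fun w => by rw [blk_apply, h1]; rfl
    rw [h2, hs, lp.single_zero]

/-! ### The trace -/

theorem block_apply (T : HS →L[ℂ] HS) (n : ℕ) (i j : Fin 2) :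
    block T n i j = blk T n (EuclideanSpace.single j 1) i := rfl

/-- A full block has trace `2 * 2^{-(n+2)} = 2^{-(n+1)}`, and the geometric tail from `N` on sums to
`2^{-N}`. -/
theorem trace_diagProj_le (N : ℕ) :
    trace (diagProj (Set.Iio N)ᶜ) ≤ ENNReal.ofReal ((1 / 2) ^ N) := by
  have hterm : ∀ n, ENNReal.ofReal ((1 / 2) ^ (n + 2)
      * (block (diagProj (Set.Iio N)ᶜ) n).trace.re)
      = if n < N then 0 else ENNReal.ofReal ((1 / 2) ^ (n + 1)) := fun n => by
    rw [Matrix.trace_fin_two, block_apply, block_apply, blk_apply, blk_apply]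
    split_ifs with hn
    · rw [diagProj_apply_of_notMem _ (by simpa using hn),
        diagProj_apply_of_notMem _ (by simpa using hn)]
      simp
    · rw [diagProj_apply_of_mem _ (by simpa using hn), diagProj_apply_of_mem _ (by simpa using hn)]
      congr 1
      simp
      ring
  have hshift : ∀ n : ℕ, ENNReal.ofReal ((1 / 2) ^ (n + N + 1))
      = ENNReal.ofReal ((1 / 2) ^ N) * 2⁻¹ ^ (n + 1) := fun n => by
    rw [show ((1 : ℝ) / 2) ^ (n + N + 1) = (1 / 2) ^ N * (1 / 2) ^ (n + 1) by ring,
      ENNReal.ofReal_mul (by positivity),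
      ENNReal.ofReal_pow (p := (1 : ℝ) / 2) (by norm_num) (n + 1),
      one_div, ENNReal.ofReal_inv_of_pos two_pos, ENNReal.ofReal_ofNat]
  rw [trace, tsum_congr hterm, ← ENNReal.summable.sum_add_tsum_nat_add' (k := N),
    Finset.sum_eq_zero fun n hn => if_pos (Finset.mem_range.1 hn), zero_add]
  simp only [show ∀ n, ¬ n + N < N by omega, if_false]
  rw [tsum_congr hshift, ENNReal.tsum_mul_left, ENNReal.tsum_geometric_add_one]
  simp [ENNReal.inv_mul_cancel]

theorem C2.apply_eq (L : C2 →L[ℂ] C2) (v : C2) (i : Fin 2) :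
    L v i = v 0 * L (EuclideanSpace.single 0 1) i + v 1 * L (EuclideanSpace.single 1 1) i := by
  have hv : v = v 0 • EuclideanSpace.single 0 (1 : ℂ) + v 1 • EuclideanSpace.single 1 (1 : ℂ) := by
    ext j
    fin_cases j <;> simp
  conv_lhs => rw [hv]
  simp

/-- An operator of small trace with an idempotent block vanishes in this block. -/
theorem blk_eq_zero_of_trace_le {q : HS →L[ℂ] HS} {n : ℕ} (hq : IsIdempotentElem (blk q n)) {s : ℝ}
    (hs : s < (1 / 2) ^ (n + 2)) (htr : trace q ≤ ENNReal.ofReal s) : blk q n = 0 := by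
  have hent : ∀ i j, block q n i j = block q n 0 j * block q n i 0
      + block q n 1 j * block q n i 1 := fun i j => by
    have h := congrArg (fun L : C2 →L[ℂ] C2 => L (EuclideanSpace.single j 1) i) hq.eq
    change blk q n (blk q n (EuclideanSpace.single j 1)) i = _ at h
    rw [C2.apply_eq] at h
    exact h.symm
  have hre : (block q n 0 0 + block q n 1 1).re < 1 := by
    have h1 : ENNReal.ofReal ((1 / 2) ^ (n + 2) * (block q n).trace.re) ≤ ENNReal.ofReal s :=
      (ENNReal.le_tsum n).trans htr
    rw [Matrix.trace_fin_two] at h1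
    by_contra hge
    have h2 : ((1 : ℝ) / 2) ^ (n + 2) ≤ (1 / 2) ^ (n + 2) * (block q n 0 0 + block q n 1 1).re :=
      le_mul_of_one_le_right (by positivity) (not_lt.1 hge)
    have h3 : (0 : ℝ) < (1 / 2) ^ (n + 2) := by positivity
    exact absurd h1 (not_le.2 ((ENNReal.ofReal_lt_ofReal_iff (h3.trans_le h2)).2 (hs.trans_le h2)))
  -- Idempotency makes each off-diagonal entry times (block trace minus `1`) vanish. As the block
  -- trace has real part below `1`, the block is diagonal with entries `0` or `1`, and both must be
  -- `0`.
  have hne : block q n 0 0 + block q n 1 1 - 1 ≠ 0 := fun h => by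
    rw [sub_eq_zero.1 h] at hre
    simp at hre
  have h01 : block q n 0 1 = 0 := by
    have h := hent 0 1
    exact (mul_eq_zero.1 (show block q n 0 1 * (block q n 0 0 + block q n 1 1 - 1) = 0 by
      linear_combination -h)).resolve_right hne
  have h10 : block q n 1 0 = 0 := by
    have h := hent 1 0
    exact (mul_eq_zero.1 (show block q n 1 0 * (block q n 0 0 + block q n 1 1 - 1) = 0 by
      linear_combination -h)).resolve_right hne
  have hdiag : ∀ z : ℂ, z = z * z → z = 0 ∨ z = 1 := fun z hz => by
    have : z * (z - 1) = 0 := by linear_combination -hz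
    exact (mul_eq_zero.1 this).imp id fun h => sub_eq_zero.1 h
  have h00 := hdiag _ (by have h := hent 0 0; rwa [h10, zero_mul, add_zero] at h)
  have h11 := hdiag _ (by have h := hent 1 1; rwa [h01, zero_mul, zero_add] at h)
  have hall : ∀ i j, block q n i j = 0 := by
    rcases h00 with h00 | h00 <;> rcases h11 with h11 | h11
    · intro i j
      fin_cases i <;> fin_cases j <;> assumption
    all_goals
      rw [h00, h11] at hre
      norm_num at hre
  ext v i
  rw [C2.apply_eq, ← block_apply, ← block_apply, hall, hall]
  simp

/-! ### Singular values of block diagonal operators -/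

theorem diagProj_Iio_mem_domain (d : ℕ → C2 →L[ℂ] C2) (N : ℕ) (ξ : HS) :
    diagProj (Set.Iio N) ξ ∈ (blockOp d).domain := by
  rw [diagProj_Iio]
  exact Submodule.sum_mem _ fun n _ => single_mem_blockOp_domain d n _

/-- The witness is the projection onto blocks `0, …, n`, whose complement has trace at most
`2^{-(n+1)}`. -/
theorem mem_singularValue_set {n : ℕ} {c s : ℝ} (hc : 0 ≤ c) (hd : ∀ k ≤ n, ‖d k‖ ≤ c)
    (hs : (1 / 2) ^ (n + 1) ≤ s) :
    c ∈ {c : ℝ | 0 ≤ c ∧ ∃ p, IsProj wotClosure p ∧ trace (1 - p) ≤ ENNReal.ofReal s ∧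
      ∀ ξ, ∃ h : p ξ ∈ (blockOp d).domain, ‖blockOp d ⟨p ξ, h⟩‖ ≤ c * ‖ξ‖} := by
  refine ⟨hc, diagProj (Set.Iio (n + 1)), isProj_diagProj _, ?_, fun ξ =>
    ⟨diagProj_Iio_mem_domain d _ ξ, norm_le_mul_norm hc fun k => ?_⟩⟩
  · rw [one_sub_diagProj]
    exact (trace_diagProj_le _).trans (ENNReal.ofReal_le_ofReal hs)
  · change ‖d k (diagProj (Set.Iio (n + 1)) ξ k)‖ ≤ _
    by_cases hk : k ∈ Set.Iio (n + 1)
    · rw [diagProj_apply_of_mem _ hk]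
      exact ((d k).le_opNorm _).trans
        (mul_le_mul_of_nonneg_right (hd k (Nat.lt_succ_iff.1 hk)) (norm_nonneg _))
    · rw [diagProj_apply_of_notMem _ hk, map_zero, norm_zero]
      positivity

theorem singularValue_blockOp_le {n : ℕ} {c s : ℝ} (hc : 0 ≤ c) (hd : ∀ k ≤ n, ‖d k‖ ≤ c)
    (hs : (1 / 2) ^ (n + 1) ≤ s) : singularValue wotClosure trace (blockOp d) s ≤ c :=
  csInf_le ⟨0, fun _ h => h.1⟩ (mem_singularValue_set hc hd hs)

theorem singularValue_set_nonempty (d : ℕ → C2 →L[ℂ] C2) {s : ℝ} (hs : 0 < s) :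
    {c : ℝ | 0 ≤ c ∧ ∃ p, IsProj wotClosure p ∧ trace (1 - p) ≤ ENNReal.ofReal s ∧
      ∀ ξ, ∃ h : p ξ ∈ (blockOp d).domain, ‖blockOp d ⟨p ξ, h⟩‖ ≤ c * ‖ξ‖}.Nonempty := by
  obtain ⟨n, hn⟩ := exists_pow_lt_of_lt_one hs (show (1 / 2 : ℝ) < 1 by norm_num)
  refine ⟨∑ k ∈ Finset.range (n + 1), ‖d k‖, mem_singularValue_set (n := n)
    (Finset.sum_nonneg fun _ _ => norm_nonneg _) (fun k hk => ?_)
    ((pow_le_pow_of_le_one (by norm_num) (by norm_num) n.le_succ).trans hn.le)⟩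
  exact Finset.single_le_sum (f := fun k => ‖d k‖) (fun _ _ => norm_nonneg _)
    (Finset.mem_range.2 (Nat.lt_succ_of_le hk))

theorem singularValue_nonneg (x : HS →ₗ.[ℂ] HS) (s : ℝ) :
    0 ≤ singularValue wotClosure trace x s :=
  Real.sInf_nonneg fun _ h => h.1

theorem antitoneOn_singularValue_blockOp (d : ℕ → C2 →L[ℂ] C2) :
    AntitoneOn (singularValue wotClosure trace (blockOp d)) (Set.Ioo 0 1) :=
  fun _ hs _ _ hst => csInf_le_csInf ⟨0, fun _ h => h.1⟩ (singularValue_set_nonempty d hs.1)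
    fun _ ⟨hc, p, hp, htr, hb⟩ => ⟨hc, p, hp, htr.trans (ENNReal.ofReal_le_ofReal hst), hb⟩

/-- A competing projection `p` has `τ (1 - p)` below the weight `2^{-(n+2)}` of a minimal projection
of block `n`, so it fixes that block, and the bound for `x p` applies to `v` itself. -/
theorem le_singularValue_blockOp {n : ℕ} {s : ℝ} (hs0 : 0 < s) (hs : s < (1 / 2) ^ (n + 2))
    {v : C2} (hv : ‖v‖ = 1) : ‖d n v‖ ≤ singularValue wotClosure trace (blockOp d) s := by
  refine le_csInf (singularValue_set_nonempty d hs0) ?_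
  rintro c ⟨-, p, hp, htr, hb⟩
  have hsub : blk (1 - p) n = 1 - blk p n := by
    rw [blk_sub]
    congr 1
    ext1 v
    rw [blk_apply, one_apply_eq_self, lp.single_apply_self,
      one_apply_eq_self]
  have hid : IsIdempotentElem (blk p n) := by
    rw [IsIdempotentElem, ← blk_mul hp.1, hp.2.isIdempotentElem.eq]
  have hq := blk_eq_zero_of_trace_le (q := 1 - p) (by rw [hsub]; exact hid.one_sub) hs htr
  rw [hsub, sub_eq_zero] at hq
  obtain ⟨h, hle⟩ := hb (lp.single 2 n v)
  rw [lp.norm_single two_pos, hv, mul_one] at hle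
  refine le_trans (le_of_eq_of_le ?_ (norm_coord_le _ n)) hle
  change ‖d n v‖ = ‖d n (p (lp.single 2 n v) n)‖
  rw [← blk_apply, ← hq]
  rfl

theorem blockOp_mem_tauMeasurableOps (d : ℕ → C2 →L[ℂ] C2) :
    blockOp d ∈ tauMeasurableOps wotClosure trace := by
  have hex : ∀ Q : (HS →L[ℂ] HS) → Prop, (∀ N, Q (diagProj (Set.Iio N)ᶜ)) →
      HasExhaustingProj wotClosure Q (blockOp d) := fun Q hQ =>
    ⟨fun N => diagProj (Set.Iio N), fun N => isProj_diagProj _,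
      fun _ _ h => diagProj_mono (Set.Iio_subset_Iio h), tendsto_diagProj_Iio,
      diagProj_Iio_mem_domain d, fun N => by rw [one_sub_diagProj]; exact hQ N⟩
  exact ⟨⟨isAffiliated_blockOp d, hex _ fun N => isFiniteProj_diagProj _⟩,
    hex _ fun N => (trace_diagProj_le N).trans_lt ENNReal.ofReal_lt_top⟩

/-! ### The derivation -/

/-- The matrix unit `e_{0 i}` of `M₂`, as an operator. -/
def matUnit (i : Fin 2) : C2 →L[ℂ] C2 :=
  (EuclideanSpace.proj i : C2 →L[ℂ] ℂ).smulRight (EuclideanSpace.single 0 (1 : ℂ))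

theorem matUnit_apply (i : Fin 2) (v : C2) :
    matUnit i v = v i • EuclideanSpace.single 0 (1 : ℂ) := rfl

/-- The blocks of the commutator of `x` with the block diagonal operator with blocks
`c n • e_{01}`. -/
def commBlocks (c : ℕ → ℝ) (x : HS →L[ℂ] HS) (n : ℕ) : C2 →L[ℂ] C2 :=
  blk x n * ((c n : ℂ) • matUnit 1) - ((c n : ℂ) • matUnit 1) * blk x n

theorem norm_commBlocks_le {c : ℕ → ℝ} (hc : ∀ n, 0 ≤ c n) (x : HS →L[ℂ] HS) (n : ℕ) :
    ‖commBlocks c x n‖ ≤ 2 * ‖matUnit 1‖ * ‖blk x n‖ * c n := by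
  have hz : ‖(c n : ℂ) • matUnit 1‖ = c n * ‖matUnit 1‖ := by
    rw [norm_smul, Complex.norm_real, Real.norm_of_nonneg (hc n)]
  calc ‖commBlocks c x n‖
      ≤ ‖blk x n * ((c n : ℂ) • matUnit 1)‖ + ‖((c n : ℂ) • matUnit 1) * blk x n‖ :=
        norm_sub_le _ _
    _ ≤ ‖blk x n‖ * (c n * ‖matUnit 1‖) + c n * ‖matUnit 1‖ * ‖blk x n‖ := by
        rw [← hz]
        exact add_le_add (norm_mul_le _ _) (norm_mul_le _ _)
    _ = _ := by ring

/-- The first `L` blocks go into the constant `R`. For later `k ≤ n` the factor multiplying `c k` is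
below `ε`, and `c k ≤ c n`. -/
theorem singularValue_commBlocks_le {c : ℕ → ℝ} (hc : ∀ n, 0 ≤ c n) (hmono : Monotone c)
    {x : HS →L[ℂ] HS} (hx : x ∈ normClosure) {ε : ℝ} (hε : 0 < ε) :
    ∃ R, ∀ n, ∀ t ∈ Set.Ioo (0 : ℝ) 1, (1 / 2) ^ (n + 1) ≤ t →
      singularValue wotClosure trace (blockOp (commBlocks c x)) t ≤ R + ε * c n := by
  have htend : Tendsto (fun n => 2 * ‖matUnit 1‖ * ‖blk x n‖) atTop (𝓝 0) := by
    simpa using (tendsto_norm_blk hx).const_mul (2 * ‖matUnit 1‖)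
  obtain ⟨L, hL⟩ := eventually_atTop.1 (htend.eventually (gt_mem_nhds hε))
  have hR : 0 ≤ ∑ k ∈ Finset.range L, ‖commBlocks c x k‖ :=
    Finset.sum_nonneg fun _ _ => norm_nonneg _
  refine ⟨∑ k ∈ Finset.range L, ‖commBlocks c x k‖, fun n t _ hnt =>
    singularValue_blockOp_le (add_nonneg hR (mul_nonneg hε.le (hc n))) (fun k hk => ?_) hnt⟩
  rcases lt_or_ge k L with hkL | hkL
  · refine (Finset.single_le_sum (f := fun k => ‖commBlocks c x k‖) (fun _ _ => norm_nonneg _)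
      (Finset.mem_range.2 hkL)).trans (le_add_of_nonneg_right (mul_nonneg hε.le (hc n)))
  · refine le_trans ?_ (le_add_of_nonneg_left hR)
    exact (norm_commBlocks_le hc x k).trans
      (mul_le_mul (hL k hkL).le (hmono hk) (hc k) hε.le)

theorem isDerivation_commBlocks {c : ℕ → ℝ} {J : Set (HS →ₗ.[ℂ] HS)}
    (hJ : ∀ x ∈ normClosure, blockOp (commBlocks c x) ∈ J) :
    IsDerivation normClosure J fun x => blockOp (commBlocks c x) where
  map_mem x := hJ x x.2
  map_add x y := by
    rw [strongAdd_blockOp]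
    congr 1
    funext n
    simp only [commBlocks, NonUnitalStarSubalgebra.coe_add, blk_add]
    generalize (c n : ℂ) • matUnit 1 = z
    noncomm_ring
  map_smul r x := by
    rw [strongSMul_blockOp]
    congr 1
    funext n
    simp only [commBlocks, NonUnitalStarSubalgebra.coe_smul, blk_smul, smul_sub, smul_mul_assoc,
      mul_smul_comm, smul_comm r]
  leibniz x y := by
    have hx := normClosure_subset_wotClosure x.2
    have hy := normClosure_subset_wotClosure y.2
    rw [ofBounded_eq_blockOp hx, ofBounded_eq_blockOp hy, strongMul_blockOp, strongMul_blockOp,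
      strongAdd_blockOp]
    congr 1
    funext n
    simp only [commBlocks, NonUnitalStarSubalgebra.coe_mul, blk_mul hy]
    generalize (c n : ℂ) • matUnit 1 = z
    simp only [mul_sub, sub_mul, mul_assoc]
    abel

/-- If a block diagonal operator implements the derivation, its entries `(0,1)` are `c n`. -/
theorem le_norm_of_implements {c : ℕ → ℝ} (hc : ∀ n, 0 ≤ c n)
    (h : ∀ x : normClosure, blockOp (commBlocks c x) =
      strongSub (strongMul (ofBounded x) (blockOp d)) (strongMul (blockOp d) (ofBounded x)))
    (n : ℕ) : c n ≤ ‖d n (EuclideanSpace.single 1 1)‖ := by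
  -- The test element is `e_{00}` in block `n`: its commutator with `c n • e_{01}` is `c n •
  -- e_{01}`, while the `(0,1)` entry of its commutator with `d n` is that of `d n`.
  have hmem : singleBlock n (matUnit 0) ∈ normClosure :=
    subset_closure (singleBlock_mem_algSum n _)
  have hb : blk (singleBlock n (matUnit 0)) n = matUnit 0 := by
    ext1 v
    rw [blk_apply, singleBlock_apply, lp.single_apply_self, lp.single_apply_self]
  have h1 := h ⟨_, hmem⟩
  rw [ofBounded_eq_blockOp (normClosure_subset_wotClosure hmem), strongMul_blockOp,
    strongMul_blockOp, strongSub_blockOp] at h1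
  have h2 := congrFun (blockOp_injective h1) n
  simp only [commBlocks, hb] at h2
  have h3 := congrArg (fun L : C2 →L[ℂ] C2 => L (EuclideanSpace.single 1 1) 0) h2
  have h4 : (c n : ℂ) = d n (EuclideanSpace.single 1 1) 0 := by
    simpa [matUnit_apply] using h3
  calc c n = ‖d n (EuclideanSpace.single 1 1) 0‖ := by
        rw [← h4, Complex.norm_real, Real.norm_of_nonneg (hc n)]
    _ ≤ _ := PiLp.norm_apply_le _ _

end OuterDerivation
end

theorem mainTheorem9 (E : OuterDerivation.SymmetricFunctionSpace) (hE : ¬ E.HasLevi) :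
    ∃ δ : OuterDerivation.normClosure → (OuterDerivation.HS →ₗ.[ℂ] OuterDerivation.HS),
      OuterDerivation.IsDerivation OuterDerivation.normClosure
        (OuterDerivation.symmetricOps E OuterDerivation.wotClosure OuterDerivation.trace) δ ∧
      ¬ OuterDerivation.IsInner OuterDerivation.normClosure
        (OuterDerivation.symmetricOps E OuterDerivation.wotClosure OuterDerivation.trace) δ := by
  open OuterDerivation in
  obtain ⟨c, hc0, hcmono, hA, hB⟩ := SymmetricFunctionSpace.exists_coefficients hE
  refine ⟨fun x => blockOp (commBlocks c x), isDerivation_commBlocks fun x hx => ?_, ?_⟩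
  · obtain ⟨C, f, hf, -⟩ := hA (singularValue wotClosure trace (blockOp (commBlocks c x)))
      (aemeasurable_restrict_of_antitoneOn measurableSet_Ioo (antitoneOn_singularValue_blockOp _))
      (fun t _ => singularValue_nonneg _ t)
      (fun ε hε => singularValue_commBlocks_le hc0 hcmono hx hε)
    exact ⟨blockOp_mem_tauMeasurableOps _, f, f.2, hf⟩
  · rintro ⟨z, ⟨hz, f, hfE, hf⟩, hinner⟩
    obtain ⟨d, rfl⟩ := hz.1.1.exists_eq_blockOp
    -- An implementing operator in `E(M, τ)` would put into `E` a function that is at least `c n` on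
    -- `(0, 2^{-(n+2)})` for every `n`.
    refine hB (singularValue wotClosure trace (blockOp d)) (fun n t ht => ?_) _
      ⟨⟨f, hfE⟩, hf, le_rfl⟩
    exact (le_norm_of_implements hc0 hinner n).trans
      (le_singularValue_blockOp ht.1 ht.2 (by simp))
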